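/- **Setting.** Let $\alpha\ge 1$ be real and let $\gamma=(\gamma_j)_{j\ge1}$ satisfy $1\ge\gamma_1\ge\gamma_2\ge\cdots>0$. For $k\in\mathbb N_0$ let $H_k(x)=\frac{(-1)^k}{\sqrt{k!}}e^{x^2/2}\frac{d^k}{dx^k}e^{-x^2/2}$, and for $\boldsymbol k\in\mathbb N_0^s$, $\boldsymbol x\in\mathbb R^s$ let $H_{\boldsymbol k}(\boldsymbol x)=\prod_{j=1}^sH_{k_j}(x_j)$. Let $\varphi_s$ be the standard normal density on $\mathbb R^s$. Put $r_{s,\alpha,\gamma}(\boldsymbol k)=\prod_{j=1}^s r_{\alpha,\gamma_j}(k_j)$, where for $\eta\in(0,1]$ $$r_{\alpha,\eta}(k)=\begin{cases}1&k=0,\\ \eta\,\frac1{k!}&1\le k<\alpha,\\ \eta\,\frac{(k-\alpha)!}{k!}&k\ge\alpha,\ k\ge 1,\end{cases}\qquad (k-\alpha)!:=\Gamma(k-\alpha+1).$$ The Gaussian ANOVA space $\mathcal H_{r_{s,\alpha,\gamma}}$ is the reproducing kernel Hilbert space of functions on $\mathbb R^s$ with kernel $K(\boldsymbol x,\boldsymbol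 y)=\sum_{\boldsymbol k\in\mathbb N_0^s}r_{s,\alpha,\gamma}(\boldsymbol k)H_{\boldsymbol k}(\boldsymbol x)H_{\boldsymbol k}(\boldsymbol y)$; its norm is written $\|\cdot\|$. For $n\in\mathbb N_0$ let $$e(n,s)=\inf_{L_i,\,g_i}\ \sup_{\|f\|\le1}\Big\|f-\sum_{i=1}^nL_i(f)\,g_i\Big\|_{L_2(\mathbb R^s,\varphi_s)},$$ where the infimum is over all continuous linear functionals $L_1,\dots,L_n$ on $\mathcal H_{r_{s,\alpha,\gamma}}$ (the information class $\Lambda^{\rm all}$) and all $g_1,\dots,g_n\in L_2(\mathbb R^s,\varphi_s)$. For $\varepsilon\in(0,1)$ and $s\in\mathbb N=\{1,2,\dots\}$ the information complexity is $n(\varepsilon,s)=\min\{n\in\mathbb N_0: e(n,s)\le\varepsilon\}$. **Notions of tractability.** In the following inequalities, $s$ ranges over $\mathbb N$ and $\varepsilon$ over $(0,1)$. * PT: there are $\tau,\sigma,C\ge0$ with $n(\varepsilon,s)\le C\varepsilon^{-\tau}s^{\sigma}$ for all $s,\varepsilon$. * SPT: there are $\tau,C\ge0$ with $n(\varepsilon,s)\le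 C\varepsilon^{-\tau}$ for all $s,\varepsilon$. The exponent of SPT is the infimum of all $\tau\ge0$ for which this holds with some $C>0$. * QPT: there are $\tau,C\ge0$ with $n(\varepsilon,s)\le C\exp(\tau(1+\ln s)(1+\ln\varepsilon^{-1}))$ for all $s,\varepsilon$. The exponent of QPT is the infimum of all $\tau\ge0$ for which this holds with some $C>0$. * WT: $\lim_{s+\varepsilon^{-1}\to\infty}\frac{\ln n(\varepsilon,s)}{s+\varepsilon^{-1}}=0$. * $(\sigma,\tau)$-WT, for $\sigma,\tau>0$: $\lim_{s+\varepsilon^{-1}\to\infty}\frac{\ln n(\varepsilon,s)}{s^\sigma+\varepsilon^{-\tau}}=0$. * UWT: $(\sigma,\tau)$-WT for all $\sigma,\tau\in(0,1]$. Let $\gamma_I=\inf_{j\ge1}\gamma_j$ and $s_\gamma=\inf\{\kappa>0:\sum_{j\ge1}\gamma_j^\kappa<\infty\}$, with $\inf\emptyset=\infty$. **Theorem.** The minimum defining $n(\varepsilon,s)$ exists for all $s\in\mathbb N$ and $\varepsilon\in(0,1)$, and: 1. SPT holds if and only if $s_\gamma<\infty$. In this case the exponent of SPT is $2\max(1/\alpha,s_\gamma)$.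 2. SPT and PT are equivalent. 3. QPT, UWT and WT are equivalent, and they hold if and only if $\gamma_I<1$. In this case the exponent of QPT is $2\max\left(\frac1\alpha,\frac1{\ln\gamma_I^{-1}}\right)$ if $\gamma_I\ne0$, and $\frac2\alpha$ if $\gamma_I=0$. 4. For all $\sigma>1$ and all $\tau>0$, $(\sigma,\tau)$-WT holds. -/

import Mathlib

open MeasureTheory ProbabilityTheory Filter Topology
open scoped ENNReal InnerProductSpace

noncomputable section

namespace HermiteTractability

/-! ### Hermite polynomials and the Gaussian measure -/

/-- The normalized `k`-th (probabilists') Hermite polynomial `H_k` as a function on `ℝ`. -/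
def hermiteFun (k : ℕ) (x : ℝ) : ℝ :=
  Polynomial.aeval x (Polynomial.hermite k) / √(k.factorial : ℝ)

/-- Rodrigues' formula: `hermiteFun` is the function
`H_k(x) = (-1)^k / √(k!) * exp(x²/2) * (d/dx)^k exp(-x²/2)`. -/
theorem hermiteFun_eq (k : ℕ) (x : ℝ) :
    hermiteFun k x = (-1 : ℝ) ^ k / √(k.factorial : ℝ) * Real.exp (x ^ 2 / 2) *
      deriv^[k] (fun y => Real.exp (-(y ^ 2 / 2))) x := by
  rw [hermiteFun, Polynomial.hermite_eq_deriv_gaussian']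
  ring

/-- The multivariate Hermite polynomial `H_k(x) = ∏_j H_{k_j}(x_j)`. -/
def hermiteMulti {s : ℕ} (k : Fin s → ℕ) (x : Fin s → ℝ) : ℝ :=
  ∏ j, hermiteFun (k j) (x j)

/-- The standard Gaussian measure `φ_s(x) dx` on `ℝ^s`. -/
abbrev gaussianMeasure (s : ℕ) : Measure (Fin s → ℝ) :=
  Measure.pi fun _ => gaussianReal 0 1

/-! ### Hermite kernels and Hermite spaces -/

/-- The Hermite kernel `K_R(x, y) = ∑_k R(k) H_k(x) H_k(y)`, in the form (a matrix of operators
on the one-dimensional space of values) in which Mathlib treats reproducing kernels. -/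
def hermiteKernel {s : ℕ} (R : (Fin s → ℕ) → ℝ) :
    Matrix (Fin s → ℝ) (Fin s → ℝ) (ℝ →L[ℝ] ℝ) :=
  Matrix.of fun x y =>
    (∑' k, R k * hermiteMulti k x * hermiteMulti k y) • ContinuousLinearMap.id ℝ ℝ

/-- The Hermite space `ℋ_R`: the reproducing kernel Hilbert space with kernel `K_R`. Its elements
are (coerced to) functions on `ℝ^s`. -/
abbrev HermiteSpace {s : ℕ} (R : (Fin s → ℕ) → ℝ) [Fact (hermiteKernel R).PosSemidef] : Type :=
  RKHS.OfKernel (hermiteKernel R)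

theorem kernel_hermiteSpace {s : ℕ} (R : (Fin s → ℕ) → ℝ) [Fact (hermiteKernel R).PosSemidef] :
    RKHS.kernel (HermiteSpace R) = hermiteKernel R :=
  RKHS.OfKernel.kernel_ofKernel

/-! ### Fourier weights of the Gaussian ANOVA space -/

/-- Sequences of product weights `1 ≥ γ_1 ≥ γ_2 ≥ ⋯ > 0`, with `γ_{j+1}` stored at index `j`. -/
structure ProductWeights where
  /-- the weights -/
  toFun : ℕ → ℝ
  pos : ∀ j, 0 < toFun j
  le_one : ∀ j, toFun j ≤ 1
  antitone : Antitone toFun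

instance : CoeFun ProductWeights fun _ => ℕ → ℝ := ⟨ProductWeights.toFun⟩

/-- The univariate Fourier weight `r_{α,γ}(k)`, where `(k - α)!` is read as `Γ(k - α + 1)`. -/
def anovaWeight₁ (α γ : ℝ) (k : ℕ) : ℝ :=
  if k = 0 then 1
  else if (k : ℝ) < α then γ * (1 / (k.factorial : ℝ))
  else γ * (Real.Gamma ((k : ℝ) - α + 1) / (k.factorial : ℝ))

/-- The Fourier weight `r_{s,α,γ}(k) = ∏_{j=1}^s r_{α,γ_j}(k_j)`. -/
def anovaWeight (α : ℝ) (γ : ℕ → ℝ) (s : ℕ) (k : Fin s → ℕ) : ℝ :=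
  ∏ j : Fin s, anovaWeight₁ α (γ j) (k j)

/-! ### Positive semidefiniteness of the kernel of the Gaussian ANOVA space -/

section Kernel

theorem posSemidef_hermiteKernel {s : ℕ} (R : (Fin s → ℕ) → ℝ) (hR : ∀ k, 0 ≤ R k)
    (hsum : ∀ x, Summable fun k => R k * hermiteMulti k x ^ 2) :
    (hermiteKernel R).PosSemidef := by
  have hsum2 : ∀ x y, Summable fun k => R k * hermiteMulti k x * hermiteMulti k y := by
    intro x y
    refine Summable.of_norm_bounded (((hsum x).add (hsum y))) fun k => ?_
    rw [Real.norm_eq_abs, mul_assoc, abs_mul, abs_of_nonneg (hR k), ← mul_add]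
    refine mul_le_mul_of_nonneg_left ?_ (hR k)
    rw [abs_le]
    constructor <;> nlinarith [sq_nonneg (hermiteMulti k x + hermiteMulti k y),
      sq_nonneg (hermiteMulti k x - hermiteMulti k y), sq_nonneg (hermiteMulti k x),
      sq_nonneg (hermiteMulti k y)]
  refine (List.TFAE.out (RKHS.posSemidef_tfae (K := hermiteKernel R)) 0 2).mpr
    (And.intro ?_ fun vv => ?_)
  · ext x y
    simp only [hermiteKernel, Matrix.conjTranspose_apply, Matrix.of_apply, star_smul, star_trivial]
    have hid : star (ContinuousLinearMap.id ℝ ℝ) = ContinuousLinearMap.id ℝ ℝ :=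
      star_one (ℝ →L[ℝ] ℝ)
    rw [hid]
    simp [mul_right_comm]
  · have key : (vv.sum fun x w => vv.sum fun x' w' => ⟪hermiteKernel R x' x w, w'⟫_ℝ)
        = ∑' k, R k * (∑ x ∈ vv.support, vv x * hermiteMulti k x) ^ 2 := by
      have h1 : ∀ k, R k * (∑ x ∈ vv.support, vv x * hermiteMulti k x) ^ 2
          = ∑ x ∈ vv.support, ∑ x' ∈ vv.support,
            (vv x * vv x') * (R k * hermiteMulti k x' * hermiteMulti k x) := by
        intro k
        rw [sq, Finset.sum_mul_sum, Finset.mul_sum]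
        refine Finset.sum_congr rfl fun x _ => ?_
        rw [Finset.mul_sum]
        refine Finset.sum_congr rfl fun x' _ => ?_
        ring
      simp_rw [h1]
      rw [Summable.tsum_finsetSum fun x _ => summable_sum fun x' _ => (hsum2 x' x).mul_left _]
      simp only [Finsupp.sum]
      refine Finset.sum_congr rfl fun x _ => ?_
      rw [Summable.tsum_finsetSum fun x' _ => (hsum2 x' x).mul_left _]
      refine Finset.sum_congr rfl fun x' _ => ?_
      rw [tsum_mul_left]
      simp [hermiteKernel]
      ring
    rw [key]
    exact tsum_nonneg fun k => mul_nonneg (hR k) (sq_nonneg _)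

theorem summable_prod_of_summable {s : ℕ} (a : Fin s → ℕ → ℝ) (h0 : ∀ j k, 0 ≤ a j k)
    (hs : ∀ j, Summable (a j)) : Summable fun k : Fin s → ℕ => ∏ j, a j (k j) := by
  classical
  refine summable_of_sum_le (c := ∏ j, ∑' k, a j k)
    (fun k => Finset.prod_nonneg fun j _ => h0 j _) fun S => ?_
  have hS : S ⊆ Fintype.piFinset fun j => S.image fun k => k j := by
    intro k hk
    rw [Fintype.mem_piFinset]
    exact fun j => Finset.mem_image_of_mem _ hk
  calc ∑ k ∈ S, ∏ j, a j (k j)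
      ≤ ∑ k ∈ Fintype.piFinset (fun j => S.image fun k => k j), ∏ j, a j (k j) :=
        Finset.sum_le_sum_of_subset_of_nonneg hS
          fun k _ _ => Finset.prod_nonneg fun j _ => h0 j _
    _ = ∏ j, ∑ i ∈ S.image (fun k => k j), a j i := (Finset.prod_univ_sum _ _).symm
    _ ≤ ∏ j, ∑' i, a j i := Finset.prod_le_prod
        (fun j _ => Finset.sum_nonneg fun i _ => h0 j i)
        fun j _ => (hs j).sum_le_tsum _ fun i _ => h0 j i

theorem anovaWeight₁_nonneg {α γ : ℝ} (hγ : 0 ≤ γ) (k : ℕ) : 0 ≤ anovaWeight₁ α γ k := by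
  unfold anovaWeight₁
  split_ifs with h1 h2
  · exact zero_le_one
  · positivity
  · refine mul_nonneg hγ (div_nonneg (Real.Gamma_nonneg_of_nonneg ?_) (by positivity))
    linarith [not_lt.mp h2]

theorem anovaWeight₁_le {α γ : ℝ} (hα : 1 ≤ α) (hγ1 : γ ≤ 1) (k : ℕ) :
    anovaWeight₁ α γ (k + 1) ≤ 1 / ((k : ℝ) + 1) := by
  have hk : (0 : ℝ) < (k.factorial : ℝ) := by positivity
  have hk1 : (1 : ℝ) ≤ (k.factorial : ℝ) := by
    exact_mod_cast Nat.one_le_iff_ne_zero.mpr k.factorial_ne_zero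
  have hf : ((k + 1).factorial : ℝ) = ((k : ℝ) + 1) * k.factorial := by
    rw [Nat.factorial_succ]; push_cast; ring
  have main : ∀ t : ℝ, 0 ≤ t → t ≤ k.factorial →
      γ * (t / ((k + 1).factorial : ℝ)) ≤ 1 / ((k : ℝ) + 1) := by
    intro t ht0 ht
    have h1 : t / ((k + 1).factorial : ℝ) ≤ 1 / ((k : ℝ) + 1) := by
      rw [hf, div_le_div_iff₀ (by positivity) (by positivity)]
      nlinarith [(Nat.cast_nonneg k : (0 : ℝ) ≤ k)]
    have h0 : 0 ≤ t / ((k + 1).factorial : ℝ) := by positivity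
    nlinarith
  unfold anovaWeight₁
  rw [if_neg (Nat.succ_ne_zero k)]
  split_ifs with h2
  · exact main 1 zero_le_one hk1
  · have h2' := not_lt.mp h2
    push_cast at h2' ⊢
    refine main _ (Real.Gamma_nonneg_of_nonneg (by linarith)) ?_
    have hmem : (k : ℝ) + 1 - α + 1 ∈ segment ℝ (1 : ℝ) ((k : ℝ) + 1) := by
      rw [segment_eq_Icc (by linarith [(Nat.cast_nonneg k : (0 : ℝ) ≤ k)])]
      constructor <;> linarith
    have := Real.convexOn_Gamma.le_max_of_mem_segment (x := 1) (y := (k : ℝ) + 1)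
      (by simp) (by simp only [Set.mem_Ioi]; positivity) hmem
    rw [Real.Gamma_one, Real.Gamma_nat_eq_factorial] at this
    exact this.trans (max_le hk1 le_rfl)

/-- The Gaussian weight without its normalization. -/
def gw (x : ℝ) : ℝ := Real.exp (-(x ^ 2 / 2))

theorem integrable_poly_gw (p : Polynomial ℝ) : Integrable fun x => p.eval x * gw x := by
  induction p using Polynomial.induction_on' with
  | add p q hp hq => exact (hp.add hq).congr (Filter.Eventually.of_forall fun x => by simp [add_mul])
  | monomial n a =>
    have h := integrable_rpow_mul_exp_neg_mul_sq (b := 1 / 2) (by norm_num) (s := (n : ℝ))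
      (lt_of_lt_of_le (by norm_num) (Nat.cast_nonneg n))
    have h2 := h.const_mul a
    refine h2.congr (Filter.Eventually.of_forall fun x => ?_)
    simp only [Real.rpow_natCast, Polynomial.eval_monomial, gw]
    rw [show -(1 / 2 : ℝ) * x ^ 2 = -(x ^ 2 / 2) by ring]
    ring

/-- The Hermite polynomials with real coefficients. -/
def hermR (n : ℕ) : Polynomial ℝ := (Polynomial.hermite n).map (Int.castRingHom ℝ)

theorem hermR_eval (n : ℕ) (x : ℝ) :
    (hermR n).eval x = Polynomial.aeval x (Polynomial.hermite n) := by
  rw [hermR, Polynomial.eval_map, Polynomial.aeval_def]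
  rfl

theorem hermR_succ (n : ℕ) :
    hermR (n + 1) = Polynomial.X * hermR n - Polynomial.derivative (hermR n) := by
  simp [hermR, Polynomial.hermite_succ, Polynomial.derivative_map]

theorem hasDerivAt_hermR_gw (n : ℕ) (x : ℝ) :
    HasDerivAt (fun x => -((hermR n).eval x * gw x)) ((hermR (n + 1)).eval x * gw x) x := by
  have h1 : HasDerivAt gw (gw x * (-x)) x := by
    have : HasDerivAt (fun x : ℝ => -(x ^ 2 / 2)) (-x) x := by
      have := ((hasDerivAt_pow 2 x).div_const 2).neg
      exact this.congr_deriv (by simp)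
    exact this.exp
  have h2 := (((hermR n).hasDerivAt x).mul h1).neg
  refine h2.congr_deriv ?_
  rw [hermR_succ]
  simp
  ring

theorem integral_poly_hermR_succ (p : Polynomial ℝ) (n : ℕ) :
    ∫ x, p.eval x * ((hermR (n + 1)).eval x * gw x)
      = ∫ x, (Polynomial.derivative p).eval x * ((hermR n).eval x * gw x) := by
  have hi : ∀ q r : Polynomial ℝ, Integrable fun x => q.eval x * (r.eval x * gw x) := by
    intro q r
    simpa [mul_assoc] using integrable_poly_gw (q * r)
  have := integral_mul_deriv_eq_deriv_mul_of_integrable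
    (u := fun x => p.eval x) (v := fun x => -((hermR n).eval x * gw x))
    (fun x _ => p.hasDerivAt x) (fun x _ => hasDerivAt_hermR_gw n x) (hi p _)
    (by simpa [Pi.mul_def] using (hi (Polynomial.derivative p) (hermR n)).neg)
    (by simpa [Pi.mul_def] using (hi p (hermR n)).neg)
  rw [this, ← integral_neg]
  congr 1
  ext x
  ring

theorem integral_poly_hermR (p : Polynomial ℝ) (n : ℕ) :
    ∫ x, p.eval x * ((hermR n).eval x * gw x)
      = ∫ x, (Polynomial.derivative^[n] p).eval x * gw x := by
  induction n generalizing p with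
  | zero => simp [hermR]
  | succ n ih => rw [integral_poly_hermR_succ, ih, Function.iterate_succ_apply]

theorem hermR_natDegree (n : ℕ) : (hermR n).natDegree = n := by
  rw [hermR, (Polynomial.hermite_monic n).natDegree_map, Polynomial.natDegree_hermite]

theorem integral_gw : ∫ x, gw x = √(2 * Real.pi) := by
  have := integral_gaussian (1 / 2)
  rw [show Real.pi / (1 / 2) = 2 * Real.pi by ring] at this
  rw [← this]
  congr 1
  ext x
  rw [gw]
  congr 1
  ring

theorem integral_hermR_lt {m n : ℕ} (h : m < n) :
    ∫ x, (hermR m).eval x * ((hermR n).eval x * gw x) = 0 := by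
  rw [integral_poly_hermR, Polynomial.iterate_derivative_eq_zero (by rwa [hermR_natDegree])]
  simp

theorem integral_hermR_self (n : ℕ) :
    ∫ x, (hermR n).eval x * ((hermR n).eval x * gw x) = n.factorial * √(2 * Real.pi) := by
  have h : Polynomial.derivative^[n] (hermR n) = Polynomial.C (n.factorial : ℝ) := by
    have hd : (Polynomial.derivative^[n] (hermR n)).natDegree = 0 := by
      have := Polynomial.natDegree_iterate_derivative (hermR n) n
      rw [hermR_natDegree] at this
      omega
    rw [Polynomial.eq_C_of_natDegree_eq_zero hd, Polynomial.coeff_iterate_derivative]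
    have : (hermR n).coeff n = 1 := by
      simp [hermR]
    simp [this, Nat.descFactorial_self]
  rw [integral_poly_hermR, h]
  simp only [Polynomial.eval_C]
  rw [integral_const_mul, integral_gw]

theorem integral_hermiteFun_mul (m n : ℕ) :
    ∫ x, hermiteFun m x * hermiteFun n x * gw x = if m = n then √(2 * Real.pi) else 0 := by
  have h : ∀ x, hermiteFun m x * hermiteFun n x * gw x
      = (√(m.factorial : ℝ) * √(n.factorial : ℝ))⁻¹ *
        ((hermR m).eval x * ((hermR n).eval x * gw x)) := by
    intro x
    simp only [hermiteFun, hermR_eval]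
    field_simp
  simp_rw [h]
  rw [integral_const_mul]
  split_ifs with hmn
  · subst hmn
    rw [integral_hermR_self, Real.mul_self_sqrt (by positivity)]
    field_simp
  · rcases lt_or_gt_of_ne hmn with h' | h'
    · rw [integral_hermR_lt h', mul_zero]
    · have : ∀ x, (hermR m).eval x * ((hermR n).eval x * gw x)
          = (hermR n).eval x * ((hermR m).eval x * gw x) := fun x => by ring
      simp_rw [this]
      rw [integral_hermR_lt h', mul_zero]

theorem integrable_hermiteFun_mul (m n : ℕ) :
    Integrable fun x => hermiteFun m x * hermiteFun n x * gw x := by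
  have h := (integrable_poly_gw (hermR m * hermR n)).const_mul
    (√(m.factorial : ℝ) * √(n.factorial : ℝ))⁻¹
  refine h.congr (Filter.Eventually.of_forall fun x => ?_)
  simp only [hermiteFun, ← hermR_eval, Polynomial.eval_mul]
  field_simp

theorem integrable_hermiteFun_gw (n : ℕ) : Integrable fun x => hermiteFun n x * gw x := by
  simpa [hermiteFun, hermR] using integrable_hermiteFun_mul 0 n

theorem setIntegral_hermiteFun_succ (n : ℕ) (x : ℝ) :
    ∫ y in Set.Iic x, hermiteFun (n + 1) y * gw y
      = -(hermiteFun n x * gw x) / √((n : ℝ) + 1) := by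
  have hint := fun k => integrable_poly_gw (hermR k)
  have ht : Tendsto (fun x => -((hermR n).eval x * gw x)) atBot (𝓝 0) :=
    tendsto_zero_of_hasDerivAt_of_integrableOn_Iic (a := x)
      (fun y _ => hasDerivAt_hermR_gw n y) (hint (n + 1)).integrableOn
      (hint n).neg.integrableOn
  have h := integral_Iic_of_hasDerivAt_of_tendsto' (a := x)
    (fun y _ => hasDerivAt_hermR_gw n y) (hint (n + 1)).integrableOn ht
  have h2 : ∀ y, hermiteFun (n + 1) y * gw y
      = (√((n + 1).factorial : ℝ))⁻¹ * ((hermR (n + 1)).eval y * gw y) := by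
    intro y
    rw [hermR_eval, hermiteFun]
    ring
  simp_rw [h2]
  rw [integral_const_mul, h, hermR_eval, hermiteFun, Nat.factorial_succ]
  push_cast
  rw [Real.sqrt_mul (by positivity)]
  field_simp
  ring

/-- Bessel's inequality for the indicator function of a half-line. -/
theorem summable_hermiteFun_sq (x : ℝ) : Summable fun n : ℕ => hermiteFun n x ^ 2 / ((n : ℝ) + 1) := by
  set D := √(2 * Real.pi) with hD
  have hDpos : 0 < D := by positivity
  set c : ℕ → ℝ := fun n => ∫ y in Set.Iic x, hermiteFun n y * gw y with hc
  have hgw : ∀ y, 0 ≤ gw y := fun y => (Real.exp_pos _).le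
  have hgwi : Integrable gw := by simpa using integrable_poly_gw 1
  have bessel : ∀ S : Finset ℕ, ∑ n ∈ S, c n ^ 2 ≤ D * D := by
    intro S
    set g : ℝ → ℝ := fun y => ∑ n ∈ S, c n * hermiteFun n y with hg
    have hggi : Integrable fun y => g y * g y * gw y := by
      have : (fun y => g y * g y * gw y) = fun y => ∑ m ∈ S, ∑ n ∈ S,
          c m * c n * (hermiteFun m y * hermiteFun n y * gw y) := by
        ext y
        simp only [hg]
        rw [Finset.sum_mul_sum, Finset.sum_mul]
        refine Finset.sum_congr rfl fun m _ => ?_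
        rw [Finset.sum_mul]
        exact Finset.sum_congr rfl fun n _ => by ring
      rw [this]
      exact integrable_finsetSum _ fun m _ => integrable_finsetSum _ fun n _ =>
        (integrable_hermiteFun_mul m n).const_mul _
    have hgg : ∫ y, g y * g y * gw y = D * ∑ n ∈ S, c n ^ 2 := by
      have : (fun y => g y * g y * gw y) = fun y => ∑ m ∈ S, ∑ n ∈ S,
          c m * c n * (hermiteFun m y * hermiteFun n y * gw y) := by
        ext y
        simp only [hg]
        rw [Finset.sum_mul_sum, Finset.sum_mul]
        refine Finset.sum_congr rfl fun m _ => ?_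
        rw [Finset.sum_mul]
        exact Finset.sum_congr rfl fun n _ => by ring
      rw [this, integral_finsetSum _ fun m _ => integrable_finsetSum _ fun n _ =>
        (integrable_hermiteFun_mul m n).const_mul _, Finset.mul_sum]
      refine Finset.sum_congr rfl fun m hm => ?_
      rw [integral_finsetSum _ fun n _ => (integrable_hermiteFun_mul m n).const_mul _]
      simp_rw [integral_const_mul, integral_hermiteFun_mul]
      simp [hm, hD]
      ring
    have hgi : Integrable fun y => g y * gw y := by
      have : (fun y => g y * gw y) = fun y => ∑ n ∈ S, c n * (hermiteFun n y * gw y) := by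
        ext y
        simp only [hg, Finset.sum_mul, mul_assoc]
      rw [this]
      exact integrable_finsetSum _ fun n _ => (integrable_hermiteFun_gw n).const_mul _
    have h1g : ∫ y in Set.Iic x, g y * gw y = ∑ n ∈ S, c n ^ 2 := by
      have : (fun y => g y * gw y) = fun y => ∑ n ∈ S, c n * (hermiteFun n y * gw y) := by
        ext y
        simp only [hg, Finset.sum_mul, mul_assoc]
      rw [this, integral_finsetSum _ fun n _ =>
        ((integrable_hermiteFun_gw n).const_mul _).integrableOn]
      refine Finset.sum_congr rfl fun n _ => ?_
      rw [integral_const_mul, sq]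
    have h0 : ∀ y ∈ Set.Iic x, 0 ≤ D * gw y - 2 * (g y * gw y) + D⁻¹ * (g y * g y * gw y) := by
      intro y _
      have : D * gw y - 2 * (g y * gw y) + D⁻¹ * (g y * g y * gw y)
          = D⁻¹ * (D - g y) ^ 2 * gw y := by
        field_simp
        ring
      rw [this]
      have := hgw y
      positivity
    have h3 := setIntegral_nonneg (μ := volume) measurableSet_Iic h0
    have h3' : ∫ y in Set.Iic x, (D * gw y - 2 * (g y * gw y) + D⁻¹ * (g y * g y * gw y))
        = D * (∫ y in Set.Iic x, gw y) - 2 * (∑ n ∈ S, c n ^ 2)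
          + D⁻¹ * ∫ y in Set.Iic x, g y * g y * gw y := by
      have i1 : IntegrableOn (fun y => D * gw y - 2 * (g y * gw y)) (Set.Iic x) :=
        ((hgwi.const_mul D).sub (hgi.const_mul 2)).integrableOn
      rw [integral_add i1 (hggi.const_mul _).integrableOn,
        integral_sub (hgwi.const_mul _).integrableOn (hgi.const_mul _).integrableOn,
        integral_const_mul, integral_const_mul, integral_const_mul, h1g]
    rw [h3'] at h3
    have h4 : ∫ y in Set.Iic x, gw y ≤ D := by
      rw [hD, ← integral_gw]
      exact setIntegral_le_integral hgwi (Filter.Eventually.of_forall hgw)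
    have h5 : ∫ y in Set.Iic x, g y * g y * gw y ≤ D * ∑ n ∈ S, c n ^ 2 := by
      rw [← hgg]
      exact setIntegral_le_integral hggi
        (Filter.Eventually.of_forall fun y => mul_nonneg (mul_self_nonneg _) (hgw y))
    have h6 : D⁻¹ * ∫ y in Set.Iic x, g y * g y * gw y ≤ ∑ n ∈ S, c n ^ 2 := by
      rw [inv_mul_le_iff₀ hDpos]
      exact h5
    have h7 := mul_le_mul_of_nonneg_left h4 hDpos.le
    linarith
  have hs : Summable fun n => c n ^ 2 := summable_of_sum_le (fun n => sq_nonneg _) bessel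
  have hs1 := (summable_nat_add_iff 1).mpr hs
  have hx : gw x ≠ 0 := (Real.exp_pos _).ne'
  refine (hs1.mul_left ((gw x)⁻¹ ^ 2)).congr fun n => ?_
  have hn : (0 : ℝ) < (n : ℝ) + 1 := by positivity
  simp only [hc]
  rw [setIntegral_hermiteFun_succ, div_pow, Real.sq_sqrt hn.le]
  field_simp

/-- The series defining the kernel of the Gaussian ANOVA space converges. -/
theorem summable_anovaWeight_mul_sq {α : ℝ} (hα : 1 ≤ α) (γ : ProductWeights) (s : ℕ)
    (x : Fin s → ℝ) : Summable fun k => anovaWeight α γ s k * hermiteMulti k x ^ 2 := by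
  have h := summable_prod_of_summable
    (fun (j : Fin s) k => anovaWeight₁ α (γ j) k * hermiteFun k (x j) ^ 2)
    (fun j k => mul_nonneg (anovaWeight₁_nonneg (γ.pos j).le k) (sq_nonneg _)) fun j => by
      rw [← summable_nat_add_iff 1]
      have h1 := (summable_nat_add_iff 1).mpr (summable_hermiteFun_sq (x j))
      refine Summable.of_nonneg_of_le
        (fun k => mul_nonneg (anovaWeight₁_nonneg (γ.pos j).le _) (sq_nonneg _)) (fun k => ?_)
        (h1.mul_left 2)
      have h2 := anovaWeight₁_le hα (γ.le_one j) k
      have h3 : 1 / ((k : ℝ) + 1) ≤ 2 / (((k + 1 : ℕ) : ℝ) + 1) := by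
        push_cast
        rw [div_le_div_iff₀ (by positivity) (by positivity)]
        linarith [(Nat.cast_nonneg k : (0 : ℝ) ≤ k)]
      calc anovaWeight₁ α (γ j) (k + 1) * hermiteFun (k + 1) (x j) ^ 2
          ≤ 2 / (((k + 1 : ℕ) : ℝ) + 1) * hermiteFun (k + 1) (x j) ^ 2 :=
            mul_le_mul_of_nonneg_right (h2.trans h3) (sq_nonneg _)
        _ = 2 * (hermiteFun (k + 1) (x j) ^ 2 / (((k + 1 : ℕ) : ℝ) + 1)) := by ring
  refine h.congr fun k => ?_
  simp only [anovaWeight, hermiteMulti]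
  rw [← Finset.prod_pow, Finset.prod_mul_distrib]

instance posSemidef_anovaKernel {α : ℝ} [hα : Fact (1 ≤ α)] (γ : ProductWeights) (s : ℕ) :
    Fact (hermiteKernel (anovaWeight α γ s)).PosSemidef :=
  ⟨posSemidef_hermiteKernel _
    (fun _ => Finset.prod_nonneg fun j _ => anovaWeight₁_nonneg (γ.pos j).le _)
    (summable_anovaWeight_mul_sq hα.out γ s)⟩

end Kernel

/-! ### `L₂`-approximation with arbitrary linear information -/

section Approximation

variable {s : ℕ} (R : (Fin s → ℕ) → ℝ) [Fact (hermiteKernel R).PosSemidef]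

/-- The worst-case error
`sup_{‖f‖_R ≤ 1} ‖f - ∑_{i=1}^n L_i(f) g_i‖_{L₂(ℝ^s, φ_s)}` of the linear algorithm
`A(f) = ∑_{i=1}^n L_i(f) g_i`. -/
def worstCaseError {n : ℕ} (L : Fin n → StrongDual ℝ (HermiteSpace R))
    (g : Fin n → Lp ℝ 2 (gaussianMeasure s)) : ℝ≥0∞ :=
  ⨆ (f : HermiteSpace R) (_ : ‖f‖ ≤ 1),
    eLpNorm (fun x => f x - ∑ i, L i f * g i x) 2 (gaussianMeasure s)

/-- The `n`-th minimal worst-case error `e(n, APP_R; Λ^all)`: the infimum over all algorithms that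
use `n` arbitrary continuous linear functionals. -/
def minimalError (n : ℕ) : ℝ≥0∞ :=
  ⨅ (L : Fin n → StrongDual ℝ (HermiteSpace R)) (g : Fin n → Lp ℝ 2 (gaussianMeasure s)),
    worstCaseError R L g

/-- The information complexity `n(ε, APP_R; Λ^all) = min {n : e(n, APP_R; Λ^all) ≤ ε}`. -/
def infoComplexity (ε : ℝ) : ℕ :=
  sInf {n : ℕ | minimalError R n ≤ ENNReal.ofReal ε}

end Approximation

/-! ### Notions of tractability, for an information complexity `n ε s` -/

section Tractability

variable (n : ℝ → ℕ → ℕ)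

/-- Polynomial tractability. -/
def PT : Prop := ∃ τ σ C : ℝ, 0 ≤ τ ∧ 0 ≤ σ ∧ 0 ≤ C ∧
  ∀ s : ℕ, 1 ≤ s → ∀ ε ∈ Set.Ioo (0 : ℝ) 1, (n ε s : ℝ) ≤ C * ε ^ (-τ) * (s : ℝ) ^ σ

/-- Strong polynomial tractability. -/
def SPT : Prop := ∃ τ C : ℝ, 0 ≤ τ ∧ 0 ≤ C ∧
  ∀ s : ℕ, 1 ≤ s → ∀ ε ∈ Set.Ioo (0 : ℝ) 1, (n ε s : ℝ) ≤ C * ε ^ (-τ)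

/-- The exponent of strong polynomial tractability. -/
def sptExponent : ℝ := sInf {τ : ℝ | 0 ≤ τ ∧ ∃ C : ℝ, 0 < C ∧
  ∀ s : ℕ, 1 ≤ s → ∀ ε ∈ Set.Ioo (0 : ℝ) 1, (n ε s : ℝ) ≤ C * ε ^ (-τ)}

/-- Quasi-polynomial tractability. -/
def QPT : Prop := ∃ τ C : ℝ, 0 ≤ τ ∧ 0 ≤ C ∧
  ∀ s : ℕ, 1 ≤ s → ∀ ε ∈ Set.Ioo (0 : ℝ) 1,
    (n ε s : ℝ) ≤ C * Real.exp (τ * (1 + Real.log s) * (1 + Real.log ε⁻¹))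

/-- The exponent of quasi-polynomial tractability. -/
def qptExponent : ℝ := sInf {τ : ℝ | 0 ≤ τ ∧ ∃ C : ℝ, 0 < C ∧
  ∀ s : ℕ, 1 ≤ s → ∀ ε ∈ Set.Ioo (0 : ℝ) 1,
    (n ε s : ℝ) ≤ C * Real.exp (τ * (1 + Real.log s) * (1 + Real.log ε⁻¹))}

/-- The limit process `s + ε⁻¹ → ∞` for pairs `(ε, s)` with `s ≥ 1` and `ε ∈ (0, 1)`. -/
def limitFilter : Filter (ℝ × ℕ) :=
  comap (fun p : ℝ × ℕ => (p.2 : ℝ) + p.1⁻¹) atTop ⊓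
    𝓟 {p : ℝ × ℕ | p.1 ∈ Set.Ioo (0 : ℝ) 1 ∧ 1 ≤ p.2}

/-- `(σ, τ)`-weak tractability. -/
def WeakTractability (σ τ : ℝ) : Prop :=
  Tendsto (fun p : ℝ × ℕ => Real.log (n p.1 p.2) / ((p.2 : ℝ) ^ σ + p.1 ^ (-τ)))
    limitFilter (𝓝 0)

/-- Weak tractability. -/
def WT : Prop :=
  Tendsto (fun p : ℝ × ℕ => Real.log (n p.1 p.2) / ((p.2 : ℝ) + p.1⁻¹)) limitFilter (𝓝 0)

/-- Uniform weak tractability. -/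
def UWT : Prop :=
  ∀ σ ∈ Set.Ioc (0 : ℝ) 1, ∀ τ ∈ Set.Ioc (0 : ℝ) 1, WeakTractability n σ τ

end Tractability

/-! ### Figures of the weight sequence -/

/-- The sum exponent `s_γ = inf {κ > 0 : ∑_j γ_j^κ < ∞}`, with `inf ∅ = ∞`. -/
def sumExponent (γ : ProductWeights) : ℝ≥0∞ :=
  ⨅ (κ : ℝ) (_ : 0 < κ) (_ : Summable fun j => γ j ^ κ), ENNReal.ofReal κ

/-- The infimum `γ_I` of the weights. -/
def weightInf (γ : ProductWeights) : ℝ := ⨅ j, γ j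

/-- The information complexity of `L₂`-approximation for the Gaussian ANOVA space
`ℋ_{r_{s,α,γ}}` and the information class `Λ^all`, as a function of `ε` and `s`. -/
def anovaComplexity (α : ℝ) [Fact (1 ≤ α)] (γ : ProductWeights) (ε : ℝ) (s : ℕ) : ℕ :=
  infoComplexity (anovaWeight α γ s) ε

end HermiteTractability

end

open HermiteTractability

namespace HermiteTractability

open MeasureTheory ProbabilityTheory Filter Topology
open scoped ENNReal InnerProductSpace

/-! ### Orthonormality of the Hermite polynomials -/

/-! In Hermite coefficients the space is a weighted `ℓ₂` and the embedding into `L₂` is diagonal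
with singular values `√(R k)`. Truncating to the largest weights is therefore optimal, and `n(ε, s)`
is the number of multi-indices with weight above `ε²` (`infoComplexity_eq_card`). What remains is
counting products of univariate weights.

Upper bounds come from Markov's inequality: for every `κ > 1/α` the count is at most `ε^(-2κ) ∏ (1 +
γ_j^κ ζ(κ))` with `ζ = anovaZeta α` (`anovaComplexity_le`); the restriction on `κ` reflects the
decay `k^(-α)` of the univariate weights. A fixed `κ` with `∑ γ_j^κ < ∞` gives SPT. The choice `κ (1
+ ln s)`, growing with `s`, turns the factors `γ_j^κ` into `O(1/s)` whenever `γ_I < e^(-1/κ)` and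
gives QPT. The choice `κ = 2` gives `ln n ≤ 4 ln ε⁻¹ + O(s)`, hence the weak tractability for `σ >
1`.

Lower bounds come from two families of multi-indices. The case `s = 1` forces `1/α` into both
exponents. The 0/1 multi-indices with exactly `m` ones give `n ≥ (s choose m)` as soon as `ε² <
γ_s^m`; this forces summability of the weights under PT and the term `1/ln γ_I⁻¹` under QPT. If `γ_I
= 1`, all `2^s` of the 0/1 multi-indices count and WT fails. -/

theorem continuous_hermiteFun (k : ℕ) : Continuous (hermiteFun k) := by
  unfold hermiteFun
  fun_prop

theorem continuous_hermiteMulti {s : ℕ} (k : Fin s → ℕ) : Continuous (hermiteMulti k) :=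
  continuous_finsetProd _ fun j _ => (continuous_hermiteFun (k j)).comp (continuous_apply j)

theorem gaussianPDFReal_zero_one (x : ℝ) :
    gaussianPDFReal 0 1 x = (√(2 * Real.pi))⁻¹ * gw x := by
  simp [gaussianPDFReal_def, gw, neg_div]

theorem integrable_hermiteFun_mul_gaussianReal (m n : ℕ) :
    Integrable (fun x => hermiteFun m x * hermiteFun n x) (gaussianReal 0 1) := by
  rw [gaussianReal_of_var_ne_zero _ one_ne_zero, integrable_withDensity_iff_integrable_smul'
    (measurable_gaussianPDF 0 1) (Eventually.of_forall fun x => gaussianPDF_lt_top)]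
  refine ((integrable_hermiteFun_mul m n).const_mul (√(2 * Real.pi))⁻¹).congr
    (Eventually.of_forall fun x => ?_)
  simp only [toReal_gaussianPDF, gaussianPDFReal_zero_one, smul_eq_mul]
  ring

theorem integral_hermiteFun_mul_gaussianReal (m n : ℕ) :
    ∫ x, hermiteFun m x * hermiteFun n x ∂(gaussianReal 0 1) = if m = n then 1 else 0 := by
  rw [integral_gaussianReal_eq_integral_smul one_ne_zero]
  have : ∀ x, gaussianPDFReal 0 1 x • (hermiteFun m x * hermiteFun n x)
      = (√(2 * Real.pi))⁻¹ * (hermiteFun m x * hermiteFun n x * gw x) := fun x => by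
    rw [gaussianPDFReal_zero_one, smul_eq_mul]
    ring
  simp_rw [this]
  rw [integral_const_mul, integral_hermiteFun_mul]
  split_ifs
  · exact inv_mul_cancel₀ (by positivity)
  · simp

theorem integrable_hermiteMulti_mul {s : ℕ} (k l : Fin s → ℕ) :
    Integrable (fun x => hermiteMulti k x * hermiteMulti l x) (gaussianMeasure s) := by
  simp only [hermiteMulti, ← Finset.prod_mul_distrib]
  exact Integrable.fintype_prod (f := fun j x => hermiteFun (k j) x * hermiteFun (l j) x)
    fun j => integrable_hermiteFun_mul_gaussianReal _ _

theorem integral_hermiteMulti_mul {s : ℕ} (k l : Fin s → ℕ) :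
    ∫ x, hermiteMulti k x * hermiteMulti l x ∂(gaussianMeasure s) = if k = l then 1 else 0 := by
  simp only [hermiteMulti, ← Finset.prod_mul_distrib]
  rw [integral_fintype_prod_eq_prod (fun j x => hermiteFun (k j) x * hermiteFun (l j) x)]
  simp_rw [integral_hermiteFun_mul_gaussianReal, Finset.prod_ite_zero, funext_iff]
  simp

theorem memLp_hermiteMulti {s : ℕ} (k : Fin s → ℕ) :
    MemLp (hermiteMulti k) 2 (gaussianMeasure s) := by
  rw [memLp_two_iff_integrable_sq (continuous_hermiteMulti k).aestronglyMeasurable]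
  simpa only [sq] using integrable_hermiteMulti_mul k k

/-- Parseval's identity for finite Hermite sums. -/
theorem eLpNorm_sum_hermiteMulti {s : ℕ} (T : Finset (Fin s → ℕ)) (c : (Fin s → ℕ) → ℝ) :
    eLpNorm (fun x => ∑ k ∈ T, c k * hermiteMulti k x) 2 (gaussianMeasure s)
      = ENNReal.ofReal √(∑ k ∈ T, c k ^ 2) := by
  have hm : MemLp (fun x => ∑ k ∈ T, c k * hermiteMulti k x) 2 (gaussianMeasure s) :=
    memLp_finsetSum T fun k _ => (memLp_hermiteMulti k).const_mul _
  rw [hm.eLpNorm_eq_integral_rpow_norm (by simp) (by simp)]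
  have h2 : ∀ x, ‖∑ k ∈ T, c k * hermiteMulti k x‖ ^ (2 : ℝ≥0∞).toReal
      = ∑ k ∈ T, ∑ l ∈ T, c k * c l * (hermiteMulti k x * hermiteMulti l x) := by
    intro x
    rw [ENNReal.toReal_ofNat, Real.rpow_ofNat, Real.norm_eq_abs, sq_abs, sq, Finset.sum_mul_sum]
    exact Finset.sum_congr rfl fun k _ => Finset.sum_congr rfl fun l _ => by ring
  simp_rw [h2]
  rw [integral_finsetSum _ fun k _ => integrable_finsetSum _ fun l _ =>
    (integrable_hermiteMulti_mul k l).const_mul _]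
  have h3 : ∀ k ∈ T, ∫ x, ∑ l ∈ T, c k * c l * (hermiteMulti k x * hermiteMulti l x)
      ∂(gaussianMeasure s) = c k ^ 2 := by
    intro k hk
    rw [integral_finsetSum _ fun l _ => (integrable_hermiteMulti_mul k l).const_mul _]
    simp_rw [integral_const_mul, integral_hermiteMulti_mul]
    simp [hk, sq]
  rw [Finset.sum_congr rfl h3, Real.sqrt_eq_rpow]
  simp

/-- An upper bound for the `L₂`-error of a partial sum of a pointwise convergent Hermite series. -/
theorem eLpNorm_hermite_tail_le {s : ℕ} {a : (Fin s → ℕ) → ℝ} {F : (Fin s → ℝ) → ℝ}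
    (hF : ∀ x, HasSum (fun k => a k * hermiteMulti k x) (F x)) (S : Finset (Fin s → ℕ)) {B : ℝ}
    (hB : ∀ T : Finset (Fin s → ℕ), Disjoint T S → ∑ k ∈ T, a k ^ 2 ≤ B) :
    eLpNorm (fun x => F x - ∑ k ∈ S, a k * hermiteMulti k x) 2 (gaussianMeasure s)
      ≤ ENNReal.ofReal √B := by
  classical
  -- Fatou's lemma works along sequences, so the net of finite partial sums is replaced by a cofinal
  -- sequence; this is possible because the multi-indices are countable.
  obtain ⟨u, hu⟩ := exists_seq_tendsto (atTop : Filter (Finset (Fin s → ℕ)))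
  refine (Lp.eLpNorm_lim_le_liminf_eLpNorm
    (f := fun n x => ∑ k ∈ u n, a k * hermiteMulti k x - ∑ k ∈ S, a k * hermiteMulti k x)
    (fun n => ?_) _ (Eventually.of_forall fun x => ?_)).trans ?_
  · refine Continuous.aestronglyMeasurable ?_
    have := fun k : Fin s → ℕ => continuous_hermiteMulti k
    fun_prop
  · exact ((hF x).comp hu).sub_const _
  · refine liminf_le_of_frequently_le' (Eventually.frequently ?_)
    filter_upwards [hu.eventually (eventually_ge_atTop S)] with n hn
    have : ∀ x, ∑ k ∈ u n, a k * hermiteMulti k x - ∑ k ∈ S, a k * hermiteMulti k x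
        = ∑ k ∈ u n \ S, a k * hermiteMulti k x := fun x => by
      rw [← Finset.sum_sdiff hn]
      ring
    simp_rw [this]
    rw [eLpNorm_sum_hermiteMulti]
    exact ENNReal.ofReal_le_ofReal (Real.sqrt_le_sqrt (hB _ Finset.sdiff_disjoint))

/-- Coefficients of a square-summable Hermite series are determined by its sum. -/
theorem eq_zero_of_hasSum_hermite_zero {s : ℕ} {a : (Fin s → ℕ) → ℝ}
    (ha : Summable fun k => a k ^ 2)
    (hF : ∀ x, HasSum (fun k => a k * hermiteMulti k x) 0) : a = 0 := by
  classical
  ext k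
  by_contra hk
  have hk' : 0 < a k ^ 2 := sq_pos_of_ne_zero hk
  obtain ⟨S, hS⟩ := summable_iff_vanishing_norm.mp ha (a k ^ 2 / 2) (by positivity)
  -- As the full sum is zero, the tail is minus the partial sum, whose squared norm is at least `a k
  -- ^ 2`; yet the tail bound is half of that.
  have h1 := eLpNorm_hermite_tail_le (F := fun _ => 0) hF (insert k S) (B := a k ^ 2 / 2)
    fun T hT => ((le_abs_self _).trans
      (hS T (hT.mono_right (Finset.subset_insert k S))).le)
  have h2 : (fun x => (0 : ℝ) - ∑ k ∈ insert k S, a k * hermiteMulti k x)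
      = -fun x => ∑ k ∈ insert k S, a k * hermiteMulti k x := by
    ext x
    simp
  rw [h2, eLpNorm_neg, eLpNorm_sum_hermiteMulti,
    ENNReal.ofReal_le_ofReal_iff (Real.sqrt_nonneg _), Real.sqrt_le_sqrt_iff (by positivity)] at h1
  have h3 := Finset.single_le_sum (f := fun k => a k ^ 2) (fun i _ => sq_nonneg (a i))
    (Finset.mem_insert_self k S)
  linarith

/-! ### The Hermite space as a sequence space -/

section FeatureMap

variable {s : ℕ} {R : (Fin s → ℕ) → ℝ}

theorem memℓp_hermiteFeature (hR : ∀ k, 0 ≤ R k)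
    (hsum : ∀ x, Summable fun k => R k * hermiteMulti k x ^ 2) (x : Fin s → ℝ) :
    Memℓp (E := fun _ : Fin s → ℕ => ℝ) (fun k => √(R k) * hermiteMulti k x) 2 := by
  rw [memℓp_gen_iff (by simp)]
  refine (hsum x).congr fun k => ?_
  rw [ENNReal.toReal_ofNat, Real.rpow_ofNat, Real.norm_eq_abs, sq_abs, mul_pow,
    Real.sq_sqrt (hR k)]

/-- The feature map `x ↦ (√R(k) H_k(x))_k` of the Hermite kernel. -/
noncomputable def hermiteFeature (hR : ∀ k, 0 ≤ R k)
    (hsum : ∀ x, Summable fun k => R k * hermiteMulti k x ^ 2) (x : Fin s → ℝ) :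
    lp (fun _ : Fin s → ℕ => ℝ) 2 :=
  ⟨fun k => √(R k) * hermiteMulti k x, memℓp_hermiteFeature hR hsum x⟩

theorem hasSum_inner_hermiteFeature (hR : ∀ k, 0 ≤ R k)
    (hsum : ∀ x, Summable fun k => R k * hermiteMulti k x ^ 2) (x : Fin s → ℝ)
    (w : lp (fun _ : Fin s → ℕ => ℝ) 2) :
    HasSum (fun k => √(R k) * w k * hermiteMulti k x) ⟪hermiteFeature hR hsum x, w⟫_ℝ := by
  have h : (fun k => √(R k) * w k * hermiteMulti k x)
      = fun k => ⟪hermiteFeature hR hsum x k, w k⟫_ℝ := by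
    ext k
    simp only [hermiteFeature, RCLike.inner_apply, conj_trivial]
    ring
  rw [h]
  exact lp.hasSum_inner _ _

theorem inner_hermiteFeature (hR : ∀ k, 0 ≤ R k)
    (hsum : ∀ x, Summable fun k => R k * hermiteMulti k x ^ 2) (x y : Fin s → ℝ) :
    ⟪hermiteFeature hR hsum x, hermiteFeature hR hsum y⟫_ℝ
      = ∑' k, R k * hermiteMulti k x * hermiteMulti k y := by
  rw [← (lp.hasSum_inner (𝕜 := ℝ) _ _).tsum_eq]
  refine tsum_congr fun k => ?_
  simp only [hermiteFeature, RCLike.inner_apply, conj_trivial]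
  rw [show √(R k) * hermiteMulti k y * (√(R k) * hermiteMulti k x)
    = (√(R k) * √(R k)) * hermiteMulti k x * hermiteMulti k y by ring, Real.mul_self_sqrt (hR k)]

variable [Fact (hermiteKernel R).PosSemidef]

theorem inner_kerFun_hermiteSpace (x y : Fin s → ℝ) :
    ⟪RKHS.kerFun (HermiteSpace R) x 1, RKHS.kerFun (HermiteSpace R) y 1⟫_ℝ
      = ∑' k, R k * hermiteMulti k x * hermiteMulti k y := by
  rw [← RKHS.kernel_inner, kernel_hermiteSpace]
  simp [hermiteKernel, mul_right_comm]

/-- The Hermite space is isometrically isomorphic to `ℓ₂`, with `f` corresponding to its Hermite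
coefficients divided by `√R(k)`. -/
theorem exists_hermiteSpace_isometryEquiv (hR : ∀ k, 0 < R k)
    (hR1 : ∀ k, R k ≤ 1) (hsum : ∀ x, Summable fun k => R k * hermiteMulti k x ^ 2) :
    ∃ V : HermiteSpace R ≃ₗᵢ[ℝ] lp (fun _ : Fin s → ℕ => ℝ) 2,
      ∀ f x, HasSum (fun k => √(R k) * V f k * hermiteMulti k x) (f x) := by
  have hR' := fun k => (hR k).le
  set φ := hermiteFeature hR' hsum with hφ
  -- `A` sends a formal combination of points to kernel sections, `B` to feature vectors. Both
  -- families have the same Gram matrix, so `A a ↦ B a` is isometric on a dense subspace and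
  -- extends.
  set A : ((Fin s → ℝ) →₀ ℝ) →ₗ[ℝ] HermiteSpace R :=
    Finsupp.linearCombination ℝ fun x => RKHS.kerFun (HermiteSpace R) x 1 with hA
  set B : ((Fin s → ℝ) →₀ ℝ) →ₗ[ℝ] lp (fun _ : Fin s → ℕ => ℝ) 2 :=
    Finsupp.linearCombination ℝ φ with hB
  have hnorm : ∀ a, ‖B a‖ = ‖A a‖ := by
    intro a
    rw [← sq_eq_sq₀ (norm_nonneg _) (norm_nonneg _), ← real_inner_self_eq_norm_sq,
      ← real_inner_self_eq_norm_sq, hA, hB]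
    simp only [Finsupp.linearCombination_apply, Finsupp.sum, sum_inner, inner_sum,
      real_inner_smul_left, real_inner_smul_right, inner_kerFun_hermiteSpace, hφ,
      inner_hermiteFeature]
  have hdense : DenseRange A := by
    have h := RKHS.kerFun_dense (𝕜 := ℝ) (HermiteSpace R)
    rw [← Submodule.dense_iff_topologicalClosure_eq_top] at h
    refine h.mono ?_
    rw [hA, ← LinearMap.coe_range, Finsupp.range_linearCombination, SetLike.coe_subset_coe,
      Submodule.span_le]
    rintro _ ⟨x, v, rfl⟩
    have : RKHS.kerFun (HermiteSpace R) x v = v • RKHS.kerFun (HermiteSpace R) x 1 := by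
      rw [← map_smul, smul_eq_mul, mul_one]
    rw [this]
    exact Submodule.smul_mem _ _ (Submodule.subset_span ⟨x, rfl⟩)
  set V := B.extendOfNorm A with hV
  have hVA : ∀ a, V (A a) = B a :=
    LinearMap.extendOfNorm_eq hdense ⟨1, fun a => by rw [hnorm, one_mul]⟩
  have hiso : ∀ f, ‖V f‖ = ‖f‖ := by
    intro f
    refine hdense.induction_on (p := fun f => ‖V f‖ = ‖f‖) f
      (isClosed_eq (by fun_prop) continuous_norm) fun a => ?_
    rw [hVA, hnorm]
  set W : HermiteSpace R →ₗᵢ[ℝ] lp (fun _ : Fin s → ℕ => ℝ) 2 := ⟨V.toLinearMap, hiso⟩ with hW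
  have hWφ : ∀ x, W (RKHS.kerFun (HermiteSpace R) x 1) = φ x := by
    intro x
    have := hVA (Finsupp.single x 1)
    simp only [hA, hB, Finsupp.linearCombination_single, one_smul] at this
    exact this
  -- The range is closed, so it suffices that its orthogonal complement vanishes. A vector
  -- orthogonal to all features is a square-summable Hermite series with sum zero everywhere, hence
  -- zero.
  have hsurj : Function.Surjective W := by
    refine LinearMap.range_eq_top (f := W.toLinearMap).mp ?_
    have hc : IsClosed (LinearMap.range W.toLinearMap : Set (lp (fun _ : Fin s → ℕ => ℝ) 2)) :=
      W.isometry.isClosedEmbedding.isClosed_range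
    have : CompleteSpace (LinearMap.range W.toLinearMap) := hc.completeSpace_coe
    rw [← Submodule.orthogonal_eq_bot_iff, Submodule.eq_bot_iff]
    intro w hw
    have h0 : ∀ x, HasSum (fun k => √(R k) * w k * hermiteMulti k x) 0 := by
      intro x
      have h1 : ⟪φ x, w⟫_ℝ = 0 := by
        rw [← hWφ]
        exact (Submodule.mem_orthogonal _ _).mp hw _ ⟨_, rfl⟩
      rw [← h1]
      exact hasSum_inner_hermiteFeature hR' hsum x w
    have hw2 : Summable fun k => w k ^ 2 := by
      simpa [sq] using lp.summable_inner (𝕜 := ℝ) w w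
    have h1 := eq_zero_of_hasSum_hermite_zero (a := fun k => √(R k) * w k)
      (hw2.of_nonneg_of_le (fun k => sq_nonneg _) fun k => by
        rw [mul_pow, Real.sq_sqrt (hR' k)]
        exact mul_le_of_le_one_left (sq_nonneg _) (hR1 k)) h0
    ext k
    exact (mul_eq_zero.mp (congrFun h1 k)).resolve_left (Real.sqrt_pos.mpr (hR k)).ne'
  refine ⟨LinearIsometryEquiv.ofSurjective W hsurj, fun f x => ?_⟩
  have h1 : ⟪φ x, W f⟫_ℝ = f x := by
    rw [← hWφ, W.inner_map_map, RKHS.kerFun_inner]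
    simp
  rw [← h1]
  exact hasSum_inner_hermiteFeature hR' hsum x (W f)

end FeatureMap

/-! ### The minimal errors and the information complexity -/

section MinimalError

variable {s : ℕ} {R : (Fin s → ℕ) → ℝ} [Fact (hermiteKernel R).PosSemidef]

/-- The algorithm is the Hermite partial sum over `S`. The coefficients it drops are `√(R k)` times
entries of a vector of norm at most one, and `√(R k) ≤ ε` off `S`. -/
theorem minimalError_card_le (hR : ∀ k, 0 < R k) (hR1 : ∀ k, R k ≤ 1)
    (hsum : ∀ x, Summable fun k => R k * hermiteMulti k x ^ 2) {ε : ℝ} (hε : 0 ≤ ε)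
    (S : Finset (Fin s → ℕ)) (hS : ∀ k ∉ S, R k ≤ ε ^ 2) :
    minimalError R S.card ≤ ENNReal.ofReal ε := by
  obtain ⟨V, hV⟩ := exists_hermiteSpace_isometryEquiv hR hR1 hsum
  set e := S.equivFin.symm with he
  let coord : (Fin s → ℕ) → StrongDual ℝ (HermiteSpace R) := fun k =>
    √(R k) • (lp.evalCLM ℝ (fun _ : Fin s → ℕ => ℝ) 2 k ∘L (V.toContinuousLinearEquiv : _ →L[ℝ] _))
  refine iInf₂_le_of_le (fun i => coord (e i)) (fun i => (memLp_hermiteMulti (e i : _)).toLp) ?_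
  refine iSup₂_le fun f hf => ?_
  have hcongr : (fun x => f x - ∑ i, coord (e i) f * (memLp_hermiteMulti (e i : _)).toLp _ x)
      =ᵐ[gaussianMeasure s]
        fun x => f x - ∑ k ∈ S, √(R k) * V f k * hermiteMulti k x := by
    have h : ∀ᵐ x ∂(gaussianMeasure s), ∀ i,
        (memLp_hermiteMulti (e i : _)).toLp _ x = hermiteMulti (e i : _) x :=
      ae_all_iff.mpr fun i => MemLp.coeFn_toLp _
    filter_upwards [h] with x hx
    simp_rw [hx]
    congr 1
    rw [← Finset.sum_coe_sort S, ← e.sum_comp]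
    rfl
  rw [eLpNorm_congr_ae hcongr]
  have := eLpNorm_hermite_tail_le (hV f) S (B := ε ^ 2) fun T hT => by
    calc ∑ k ∈ T, (√(R k) * V f k) ^ 2 ≤ ∑ k ∈ T, ε ^ 2 * V f k ^ 2 := by
          refine Finset.sum_le_sum fun k hk => ?_
          rw [mul_pow, Real.sq_sqrt (hR k).le]
          exact mul_le_mul_of_nonneg_right (hS k (Finset.disjoint_left.mp hT hk)) (sq_nonneg _)
      _ = ε ^ 2 * ∑ k ∈ T, V f k ^ 2 := by rw [Finset.mul_sum]
      _ ≤ ε ^ 2 * ‖V f‖ ^ 2 := by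
          refine mul_le_mul_of_nonneg_left ?_ (sq_nonneg _)
          have := lp.sum_rpow_le_norm_rpow (p := 2) (by simp) (V f) T
          simpa using this
      _ ≤ ε ^ 2 * 1 := by
          refine mul_le_mul_of_nonneg_left ?_ (sq_nonneg _)
          rw [V.norm_map]
          exact pow_le_one₀ (norm_nonneg _) hf
      _ = ε ^ 2 := mul_one _
  rwa [Real.sqrt_sq hε] at this

/-- Fewer than `T.card` functionals have a common nonzero zero in the span of the Hermite
polynomials indexed by `T`. The algorithm returns zero there, so its error is at least the `L₂` norm
of that function, which is at least `√m` times its norm in the space. -/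
theorem ofReal_sqrt_le_minimalError (hR : ∀ k, 0 < R k) (hR1 : ∀ k, R k ≤ 1)
    (hsum : ∀ x, Summable fun k => R k * hermiteMulti k x ^ 2) {m : ℝ}
    (T : Finset (Fin s → ℕ)) (hT : ∀ k ∈ T, m ≤ R k) {n : ℕ} (hn : n < T.card) :
    ENNReal.ofReal √m ≤ minimalError R n := by
  classical
  obtain ⟨V, hV⟩ := exists_hermiteSpace_isometryEquiv hR hR1 hsum
  refine le_iInf₂ fun L g => ?_
  let v : (T → ℝ) →ₗ[ℝ] lp (fun _ : Fin s → ℕ => ℝ) 2 :=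
    Fintype.linearCombination ℝ fun k : T => lp.single 2 (k : Fin s → ℕ) (1 : ℝ)
  have hv : ∀ (c : T → ℝ) k, v c k = if h : k ∈ T then c ⟨k, h⟩ else 0 := by
    intro c k
    simp only [v, Fintype.linearCombination_apply, lp.coeFn_sum, Finset.sum_apply, lp.coeFn_smul,
      Pi.smul_apply, lp.single_apply, smul_eq_mul]
    split_ifs with h
    · rw [Finset.sum_eq_single ⟨k, h⟩]
      · simp
      · intro b _ hb
        rw [Pi.single_eq_of_ne, mul_zero]
        exact fun h' => hb (Subtype.ext h'.symm)
      · simp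
    · refine Finset.sum_eq_zero fun b _ => ?_
      rw [Pi.single_eq_of_ne, mul_zero]
      rintro rfl
      exact h b.2
  let ℓ : (T → ℝ) →ₗ[ℝ] (Fin n → ℝ) :=
    LinearMap.pi fun i => (L i).toLinearMap ∘ₗ V.symm.toLinearEquiv.toLinearMap ∘ₗ v
  have hker : ℓ.ker ≠ ⊥ := LinearMap.ker_ne_bot_of_finrank_lt (by simpa using hn)
  obtain ⟨c, hc, hc0⟩ := (Submodule.ne_bot_iff _).mp hker
  have hvc : v c ≠ 0 := by
    intro h
    refine hc0 (funext fun k => ?_)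
    have := hv c k
    rw [h] at this
    simpa using this.symm
  set w := ‖v c‖⁻¹ • v c with hw
  have hw1 : ‖w‖ = 1 := norm_smul_inv_norm hvc
  have hw0 : ∀ k ∉ T, w k = 0 := by
    intro k hk
    simp [hw, hv, hk]
  set f : HermiteSpace R := V.symm w with hf
  have hLf : ∀ i, L i f = 0 := by
    intro i
    have := congrFun (LinearMap.mem_ker.mp hc) i
    have h2 : L i (V.symm (v c)) = 0 := this
    rw [hf, hw, map_smul, map_smul, h2, smul_zero]
  refine le_iSup₂_of_le f (by rw [hf, V.symm.norm_map, hw1]) ?_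
  have hfx : (fun x => f x - ∑ i, L i f * g i x)
      = fun x => ∑ k ∈ T, √(R k) * w k * hermiteMulti k x := by
    ext x
    simp only [hLf, zero_mul, Finset.sum_const_zero, sub_zero]
    have h1 := hV f x
    rw [hf, V.apply_symm_apply] at h1
    exact h1.unique (hasSum_sum_of_ne_finset_zero fun k hk => by rw [hw0 k hk]; ring)
  rw [hfx, eLpNorm_sum_hermiteMulti]
  refine ENNReal.ofReal_le_ofReal (Real.sqrt_le_sqrt ?_)
  have hw2 : ∑ k ∈ T, w k ^ 2 = 1 := by
    have h1 : HasSum (fun k => w k ^ 2) (∑ k ∈ T, w k ^ 2) :=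
      hasSum_sum_of_ne_finset_zero fun k hk => by rw [hw0 k hk]; ring
    have h2 := lp.hasSum_norm (p := 2) (by simp) w
    rw [hw1] at h2
    simp only [ENNReal.toReal_ofNat, Real.rpow_ofNat, Real.norm_eq_abs, sq_abs, one_pow] at h2
    exact h1.unique h2
  calc m = ∑ k ∈ T, m * w k ^ 2 := by rw [← Finset.mul_sum, hw2, mul_one]
    _ ≤ ∑ k ∈ T, (√(R k) * w k) ^ 2 := by
      refine Finset.sum_le_sum fun k hk => ?_
      rw [mul_pow, Real.sq_sqrt (hR k).le]
      exact mul_le_mul_of_nonneg_right (hT k hk) (sq_nonneg _)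

/-- The information complexity is the number of Fourier weights that exceed `ε²`. -/
theorem infoComplexity_eq_card (hR : ∀ k, 0 < R k) (hR1 : ∀ k, R k ≤ 1)
    (hsum : ∀ x, Summable fun k => R k * hermiteMulti k x ^ 2) {ε : ℝ} (hε : 0 < ε)
    (S : Finset (Fin s → ℕ)) (hS : ∀ k, k ∈ S ↔ ε ^ 2 < R k) :
    infoComplexity R ε = S.card := by
  refine le_antisymm (Nat.sInf_le (minimalError_card_le hR hR1 hsum hε.le S
    fun k hk => not_lt.mp (mt (hS k).mpr hk))) ?_
  refine le_csInf ⟨S.card, minimalError_card_le hR hR1 hsum hε.le S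
    fun k hk => not_lt.mp (mt (hS k).mpr hk)⟩ fun n hn => ?_
  by_contra! hlt
  -- `S` is finite, so its smallest weight is attained and is still strictly above `ε²`.
  have hne : S.Nonempty := Finset.card_pos.mp (by omega)
  obtain ⟨k₀, hk₀, hmin⟩ := S.exists_min_image R hne
  have h1 := (ofReal_sqrt_le_minimalError hR hR1 hsum S hmin hlt).trans hn
  rw [ENNReal.ofReal_le_ofReal_iff hε.le, Real.sqrt_le_iff] at h1
  exact absurd ((hS k₀).mp hk₀) (not_lt.mpr h1.2)

end MinimalError

/-! ### Asymptotics of the univariate Fourier weights -/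

section Weights

variable {α γ : ℝ}

theorem anovaWeight₁_zero : anovaWeight₁ α γ 0 = 1 := if_pos rfl

theorem anovaWeight₁_eq_mul {k : ℕ} (hk : k ≠ 0) :
    anovaWeight₁ α γ k = γ * anovaWeight₁ α 1 k := by
  simp only [anovaWeight₁, if_neg hk]
  split_ifs <;> ring

theorem anovaWeight₁_pos (hγ : 0 < γ) (k : ℕ) : 0 < anovaWeight₁ α γ k := by
  unfold anovaWeight₁
  split_ifs with h1 h2
  · exact one_pos
  · positivity
  · have := Real.Gamma_pos_of_pos (s := (k : ℝ) - α + 1) (by linarith [not_lt.mp h2])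
    positivity

theorem anovaWeight₁_le_one (hα : 1 ≤ α) (hγ1 : γ ≤ 1) (k : ℕ) : anovaWeight₁ α γ k ≤ 1 := by
  cases k with
  | zero => exact anovaWeight₁_zero.le
  | succ k =>
    refine (anovaWeight₁_le hα hγ1 k).trans ?_
    rw [div_le_one (by positivity)]
    linarith [(Nat.cast_nonneg k : (0 : ℝ) ≤ k)]

theorem anovaWeight₁_one (hα : 1 ≤ α) : anovaWeight₁ α γ 1 = γ := by
  unfold anovaWeight₁
  rcases hα.lt_or_eq with h | h
  · simp [h]
  · simp [← h]

theorem anovaWeight₁_succ (hα : 1 ≤ α) {k : ℕ} (hk : α ≤ k) :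
    anovaWeight₁ α γ (k + 1) = ((k : ℝ) + 1 - α) / (k + 1) * anovaWeight₁ α γ k := by
  have hk0 : k ≠ 0 := by
    rintro rfl
    norm_num at hk
    linarith
  simp only [anovaWeight₁, if_neg hk0, if_neg (Nat.succ_ne_zero k), if_neg hk.not_gt]
  rw [if_neg (by push_cast; linarith)]
  push_cast
  rw [show (k : ℝ) + 1 - α + 1 = ((k : ℝ) - α + 1) + 1 by ring,
    Real.Gamma_add_one (by linarith), Nat.factorial_succ]
  push_cast
  field_simp
  ring

/-- Bernoulli's inequality `(1 - 1/(k+1))^α ≥ 1 - α/(k+1)` compares the ratio of consecutive weights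
with that of `k^(-α)`. With the companion monotonicity below, it yields decay of exact order
`k^(-α)` without Stirling's formula. -/
theorem antitone_anovaWeight₁_mul_rpow (hα : 1 ≤ α) (hγ : 0 < γ) {k : ℕ} (hk : α ≤ k) :
    anovaWeight₁ α γ (k + 1) * ((k + 1 : ℕ) : ℝ) ^ α ≤ anovaWeight₁ α γ k * (k : ℝ) ^ α := by
  have hk0 : (0 : ℝ) < k := by linarith
  have hk1 : (0 : ℝ) < (k : ℝ) + 1 := by linarith
  have hb := one_add_mul_self_le_rpow_one_add (s := -(1 / ((k : ℝ) + 1))) (by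
    rw [neg_le_neg_iff, div_le_one hk1]
    linarith) hα
  rw [show 1 + -(1 / ((k : ℝ) + 1)) = k / (k + 1) by field_simp; ring,
    show 1 + α * -(1 / ((k : ℝ) + 1)) = ((k : ℝ) + 1 - α) / (k + 1) by
      field_simp; ring,
    Real.div_rpow hk0.le hk1.le, le_div_iff₀ (by positivity)] at hb
  have := mul_le_mul_of_nonneg_left hb (anovaWeight₁_pos (α := α) hγ k).le
  rw [anovaWeight₁_succ hα hk]
  push_cast
  linarith

/-- Bernoulli's inequality again, now for `(1 + 1/(k+1-α))^α`. The shift from `k` to `k + 1 - α`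
reverses the monotonicity. -/
theorem monotone_anovaWeight₁_mul_rpow (hα : 1 ≤ α) (hγ : 0 < γ) {k : ℕ} (hk : α ≤ k) :
    anovaWeight₁ α γ k * ((k : ℝ) + 1 - α) ^ α
      ≤ anovaWeight₁ α γ (k + 1) * (((k + 1 : ℕ) : ℝ) + 1 - α) ^ α := by
  have hx : 0 < (k : ℝ) + 1 - α := by linarith
  have hk1 : (0 : ℝ) < (k : ℝ) + 1 := by linarith
  have hb := one_add_mul_self_le_rpow_one_add (s := 1 / ((k : ℝ) + 1 - α))
    (by have : 0 < 1 / ((k : ℝ) + 1 - α) := by positivity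
        linarith) hα
  rw [show 1 + 1 / ((k : ℝ) + 1 - α) = ((k : ℝ) + 1 + 1 - α) / (k + 1 - α) by
      field_simp; ring,
    show 1 + α * (1 / ((k : ℝ) + 1 - α)) = ((k : ℝ) + 1) / (k + 1 - α) by field_simp; ring,
    Real.div_rpow (by linarith) hx.le, div_le_div_iff₀ hx (by positivity)] at hb
  rw [anovaWeight₁_succ hα hk]
  push_cast
  rw [div_mul_eq_mul_div, div_mul_eq_mul_div, le_div_iff₀ hk1]
  have := mul_le_mul_of_nonneg_left hb (anovaWeight₁_pos (α := α) hγ k).le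
  linarith

theorem exists_anovaWeight₁_le (hα : 1 ≤ α) : ∃ C : ℝ, 0 ≤ C ∧ ∀ᶠ k : ℕ in atTop,
    anovaWeight₁ α 1 k ≤ C * (k : ℝ) ^ (-α) := by
  set m := ⌈α⌉₊
  have hm : α ≤ m := Nat.le_ceil α
  refine ⟨anovaWeight₁ α 1 m * (m : ℝ) ^ α,
    mul_nonneg (anovaWeight₁_nonneg zero_le_one m) (by positivity), ?_⟩
  filter_upwards [eventually_ge_atTop m] with k hk
  have hk0 : (0 : ℝ) < k := by
    have : (m : ℝ) ≤ k := by exact_mod_cast hk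
    linarith
  rw [Real.rpow_neg hk0.le, ← div_eq_mul_inv, le_div_iff₀ (by positivity)]
  induction k, hk using Nat.le_induction with
  | base => exact le_rfl
  | succ k hk ih =>
    have : (m : ℝ) ≤ k := by exact_mod_cast hk
    exact (antitone_anovaWeight₁_mul_rpow hα one_pos (by linarith)).trans (ih (by linarith))

theorem exists_le_anovaWeight₁ (hα : 1 ≤ α) : ∃ c : ℝ, 0 < c ∧ ∀ k : ℕ, k ≠ 0 →
    c * (k : ℝ) ^ (-α) ≤ anovaWeight₁ α 1 k := by
  set m := ⌈α⌉₊
  have hm : α ≤ m := Nat.le_ceil α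
  have hpos := fun k => anovaWeight₁_pos (α := α) one_pos k
  obtain ⟨k₀, -, hk₀⟩ := (Finset.range (m + 1)).exists_min_image (anovaWeight₁ α 1) ⟨0, by simp⟩
  -- The first entry covers the finitely many `k < m`, where `k^(-α) ≤ 1`; the second covers `k ≥ m`
  -- by monotonicity.
  set c := min (anovaWeight₁ α 1 k₀) (anovaWeight₁ α 1 m * ((m : ℝ) + 1 - α) ^ α) with hc
  have hm1 : 0 < ((m : ℝ) + 1 - α) ^ α := Real.rpow_pos_of_pos (by linarith) _
  have hc0 : 0 < c := lt_min (hpos _) (mul_pos (hpos m) hm1)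
  refine ⟨c, hc0, fun k hk => ?_⟩
  have hk1 : (1 : ℝ) ≤ k := by exact_mod_cast Nat.one_le_iff_ne_zero.mpr hk
  rcases lt_or_ge k m with h | h
  · have h1 : (k : ℝ) ^ (-α) ≤ 1 := Real.rpow_le_one_of_one_le_of_nonpos hk1 (by linarith)
    calc c * (k : ℝ) ^ (-α) ≤ c * 1 := mul_le_mul_of_nonneg_left h1 hc0.le
      _ ≤ anovaWeight₁ α 1 k₀ := by rw [mul_one]; exact min_le_left _ _
      _ ≤ _ := hk₀ k (by simp; omega)
  · have hmono : anovaWeight₁ α 1 m * ((m : ℝ) + 1 - α) ^ α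
        ≤ anovaWeight₁ α 1 k * ((k : ℝ) + 1 - α) ^ α := by
      clear hk hk1
      induction k, h using Nat.le_induction with
      | base => exact le_rfl
      | succ k hk ih =>
        have : (m : ℝ) ≤ k := by exact_mod_cast hk
        exact ih.trans (monotone_anovaWeight₁_mul_rpow hα one_pos (by linarith))
    have hmk : (m : ℝ) ≤ k := by exact_mod_cast h
    rw [Real.rpow_neg (by linarith), ← div_eq_mul_inv, div_le_iff₀ (by positivity)]
    refine (min_le_right _ _).trans (hmono.trans (mul_le_mul_of_nonneg_left ?_ (hpos k).le))
    exact Real.rpow_le_rpow (by linarith) (by linarith) (by linarith)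

theorem summable_anovaWeight₁_rpow (hα : 1 ≤ α) {κ : ℝ} (hκ : 1 / α < κ) :
    Summable fun k : ℕ => anovaWeight₁ α 1 k ^ κ := by
  obtain ⟨C, hC, h⟩ := exists_anovaWeight₁_le hα
  have hα0 : 0 < α := by linarith
  have hκ0 : 0 < κ := (by positivity : 0 < 1 / α).trans hκ
  have hs : Summable fun k : ℕ => C ^ κ * (k : ℝ) ^ (-α * κ) := by
    refine (Real.summable_nat_rpow.mpr ?_).mul_left _
    rw [div_lt_iff₀ hα0] at hκ
    linarith
  refine hs.of_norm_bounded_eventually_nat ?_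
  filter_upwards [h] with k hk
  rw [Real.norm_of_nonneg (Real.rpow_nonneg (anovaWeight₁_nonneg zero_le_one k) _),
    Real.rpow_mul k.cast_nonneg, ← Real.mul_rpow hC (by positivity)]
  exact Real.rpow_le_rpow (anovaWeight₁_nonneg zero_le_one k) hk hκ0.le

end Weights

/-! ### Counting Fourier weights -/

/-- A finite set lies in the box of its coordinate projections, and the sum over a box factors. -/
theorem sum_prod_le_prod_tsum {s : ℕ} (a : Fin s → ℕ → ℝ) (h0 : ∀ j k, 0 ≤ a j k)
    (hs : ∀ j, Summable (a j)) (S : Finset (Fin s → ℕ)) :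
    ∑ k ∈ S, ∏ j, a j (k j) ≤ ∏ j, ∑' k, a j k := by
  classical
  have hS : S ⊆ Fintype.piFinset fun j => S.image fun k => k j := by
    intro k hk
    rw [Fintype.mem_piFinset]
    exact fun j => Finset.mem_image_of_mem _ hk
  calc ∑ k ∈ S, ∏ j, a j (k j)
      ≤ ∑ k ∈ Fintype.piFinset (fun j => S.image fun k => k j), ∏ j, a j (k j) :=
        Finset.sum_le_sum_of_subset_of_nonneg hS
          fun k _ _ => Finset.prod_nonneg fun j _ => h0 j _
    _ = ∏ j, ∑ i ∈ S.image (fun k => k j), a j i := (Finset.prod_univ_sum _ _).symm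
    _ ≤ ∏ j, ∑' i, a j i := Finset.prod_le_prod
        (fun j _ => Finset.sum_nonneg fun i _ => h0 j i)
        fun j _ => (hs j).sum_le_tsum _ fun i _ => h0 j i

/-- The sum `∑_{k ≥ 1} r_{α,1}(k)^κ`. -/
noncomputable def anovaZeta (α κ : ℝ) : ℝ := ∑' k : ℕ, anovaWeight₁ α 1 (k + 1) ^ κ

theorem anovaZeta_nonneg (α κ : ℝ) : 0 ≤ anovaZeta α κ :=
  tsum_nonneg fun _ => Real.rpow_nonneg (anovaWeight₁_nonneg zero_le_one _) _

/-- Keeps the constant uniform in `s` when the exponent grows with `s`, as in the QPT bound. -/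
theorem anovaZeta_anti {α κ κ' : ℝ} (hα : 1 ≤ α) (hκ : 1 / α < κ) (h : κ ≤ κ') :
    anovaZeta α κ' ≤ anovaZeta α κ := by
  refine Summable.tsum_le_tsum (fun k => ?_)
    ((summable_nat_add_iff 1).mpr (summable_anovaWeight₁_rpow hα (hκ.trans_le h)))
    ((summable_nat_add_iff 1).mpr (summable_anovaWeight₁_rpow hα hκ))
  exact Real.rpow_le_rpow_of_exponent_ge (anovaWeight₁_pos one_pos _)
    (anovaWeight₁_le_one hα le_rfl _) h

theorem hasSum_anovaWeight₁_rpow {α κ γ : ℝ} (hα : 1 ≤ α) (hκ : 1 / α < κ) (hγ : 0 < γ) :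
    HasSum (fun k => anovaWeight₁ α γ k ^ κ) (1 + γ ^ κ * anovaZeta α κ) := by
  rw [← hasSum_nat_add_iff' 1]
  simp only [Finset.range_one, Finset.sum_singleton, anovaWeight₁_zero, Real.one_rpow,
    add_sub_cancel_left]
  have h : (fun k : ℕ => anovaWeight₁ α γ (k + 1) ^ κ)
      = fun k => γ ^ κ * anovaWeight₁ α 1 (k + 1) ^ κ := by
    ext k
    rw [anovaWeight₁_eq_mul k.succ_ne_zero,
      Real.mul_rpow hγ.le (anovaWeight₁_nonneg zero_le_one _)]
  rw [h]
  exact ((summable_nat_add_iff 1).mpr (summable_anovaWeight₁_rpow hα hκ)).hasSum.mul_left _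

/-! ### Upper and lower bounds for the counting function -/

section Complexity

variable {α : ℝ} (γ : ProductWeights) (s : ℕ)

theorem anovaWeight_pos (k : Fin s → ℕ) : 0 < anovaWeight α γ s k :=
  Finset.prod_pos fun j _ => anovaWeight₁_pos (γ.pos j) _

theorem anovaWeight_le_one (hα : 1 ≤ α) (k : Fin s → ℕ) : anovaWeight α γ s k ≤ 1 :=
  Finset.prod_le_one (fun j _ => anovaWeight₁_nonneg (γ.pos j).le _)
    fun j _ => anovaWeight₁_le_one hα (γ.le_one j) _

theorem sum_anovaWeight_rpow_le (hα : 1 ≤ α) {κ : ℝ} (hκ : 1 / α < κ)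
    (S : Finset (Fin s → ℕ)) :
    ∑ k ∈ S, anovaWeight α γ s k ^ κ ≤ ∏ j : Fin s, (1 + γ j ^ κ * anovaZeta α κ) := by
  have h := sum_prod_le_prod_tsum (fun (j : Fin s) k => anovaWeight₁ α (γ j) k ^ κ)
    (fun j k => Real.rpow_nonneg (anovaWeight₁_nonneg (γ.pos j).le k) _)
    (fun j => (hasSum_anovaWeight₁_rpow hα hκ (γ.pos j)).summable) S
  simp_rw [(hasSum_anovaWeight₁_rpow hα hκ (γ.pos _)).tsum_eq] at h
  refine le_of_eq_of_le (Finset.sum_congr rfl fun k _ => ?_) h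
  rw [anovaWeight, Real.finsetProd_rpow _ _ fun j _ => anovaWeight₁_nonneg (γ.pos _).le _]

theorem finite_lt_anovaWeight (hα : 1 ≤ α) {δ : ℝ} (hδ : 0 < δ) :
    {k | δ < anovaWeight α γ s k}.Finite := by
  -- The exponent 2 is summable for every `α ≥ 1`; summable weights exceed a positive level only
  -- finitely often.
  have h2 : 1 / α < 2 := by rw [div_lt_iff₀ (by linarith)]; linarith
  have hs : Summable fun k => anovaWeight α γ s k ^ (2 : ℝ) :=
    summable_of_sum_le (fun k => Real.rpow_nonneg (anovaWeight_pos γ s k).le _)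
      (sum_anovaWeight_rpow_le γ s hα h2)
  have h := hs.tendsto_cofinite_zero.eventually (gt_mem_nhds (Real.rpow_pos_of_pos hδ 2))
  refine (eventually_cofinite.mp h).subset fun k hk => ?_
  exact not_lt.mpr (Real.rpow_le_rpow hδ.le (le_of_lt hk) zero_le_two)

variable [hα : Fact (1 ≤ α)] {ε : ℝ}

theorem exists_minimalError_anovaWeight_le (hε : 0 < ε) :
    ∃ n : ℕ, minimalError (anovaWeight α γ s) n ≤ ENNReal.ofReal ε := by
  have hfin := finite_lt_anovaWeight γ s hα.out (pow_pos hε 2)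
  exact ⟨_, minimalError_card_le (anovaWeight_pos γ s) (anovaWeight_le_one γ s hα.out)
    (summable_anovaWeight_mul_sq hα.out γ s) hε.le hfin.toFinset fun k hk => by simpa using hk⟩

theorem anovaComplexity_eq_card (hε : 0 < ε) :
    anovaComplexity α γ ε s
      = (finite_lt_anovaWeight γ s hα.out (pow_pos hε 2)).toFinset.card :=
  infoComplexity_eq_card (anovaWeight_pos γ s) (anovaWeight_le_one γ s hα.out)
    (summable_anovaWeight_mul_sq hα.out γ s) hε _ fun k => by simp

/-- Markov's inequality: every counted weight contributes at least `ε^(2κ)` to the sum of the `κ`-th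
powers. -/
theorem anovaComplexity_le (hε : 0 < ε) {κ : ℝ} (hκ : 1 / α < κ) :
    (anovaComplexity α γ ε s : ℝ)
      ≤ ε ^ (-(2 * κ)) * ∏ j : Fin s, (1 + γ j ^ κ * anovaZeta α κ) := by
  have hκ0 : 0 < κ := (one_div_pos.mpr (by linarith [hα.out])).trans hκ
  rw [anovaComplexity_eq_card γ s hε, Real.rpow_neg hε.le, inv_mul_eq_div,
    le_div_iff₀ (by positivity), ← nsmul_eq_mul]
  refine le_trans ?_ (sum_anovaWeight_rpow_le γ s hα.out hκ
    (finite_lt_anovaWeight γ s hα.out (pow_pos hε 2)).toFinset)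
  refine Finset.card_nsmul_le_sum _ _ _ fun k hk => ?_
  rw [Set.Finite.mem_toFinset, Set.mem_ofPred_eq] at hk
  rw [Real.rpow_mul hε.le, Real.rpow_two]
  exact Real.rpow_le_rpow (sq_nonneg _) hk.le hκ0.le

theorem card_le_anovaComplexity (hε : 0 < ε) (T : Finset (Fin s → ℕ))
    (hT : ∀ k ∈ T, ε ^ 2 < anovaWeight α γ s k) : T.card ≤ anovaComplexity α γ ε s := by
  rw [anovaComplexity_eq_card γ s hε]
  exact Finset.card_le_card fun k hk => by simpa using hT k hk

/-- A subset `A` stands for its 0/1 indicator multi-index, whose weight is the product of the `γ j`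
over `A` since `r_{α,γ}(1) = γ`. -/
theorem card_subsets_le_anovaComplexity (hε : 0 < ε) (𝒜 : Finset (Finset (Fin s)))
    (h𝒜 : ∀ A ∈ 𝒜, ε ^ 2 < ∏ j ∈ A, γ j) : 𝒜.card ≤ anovaComplexity α γ ε s := by
  classical
  have hinj : Function.Injective fun (A : Finset (Fin s)) (j : Fin s) =>
      if j ∈ A then 1 else 0 := by
    intro A B h
    ext j
    have := congrFun h j
    by_cases hA : j ∈ A <;> by_cases hB : j ∈ B <;> simp_all
  rw [← Finset.card_image_of_injective 𝒜 hinj]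
  refine card_le_anovaComplexity γ s hε _ fun k hk => ?_
  obtain ⟨A, hA, rfl⟩ := Finset.mem_image.mp hk
  refine (h𝒜 A hA).trans_eq ?_
  rw [anovaWeight, ← Finset.prod_subset A.subset_univ fun j _ hj => by
    simp [hj, anovaWeight₁_zero]]
  exact Finset.prod_congr rfl fun j hj => by simp [hj, anovaWeight₁_one hα.out]

/-- In dimension `s + 1` the smallest weight is `γ s` (indices start at zero), so every `m`-subset
has product at least `γ s ^ m`. -/
theorem choose_le_anovaComplexity (hε : 0 < ε) {m : ℕ} (h : ε ^ 2 < γ s ^ m) :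
    (s + 1).choose m ≤ anovaComplexity α γ ε (s + 1) := by
  have hc : (Finset.powersetCard m (Finset.univ : Finset (Fin (s + 1)))).card
      = (s + 1).choose m := by simp
  rw [← hc]
  refine card_subsets_le_anovaComplexity γ (s + 1) hε _ fun A hA => h.trans_le ?_
  rw [← (Finset.mem_powersetCard.mp hA).2, ← Finset.prod_const]
  exact Finset.prod_le_prod (fun _ _ => (γ.pos s).le)
    fun j _ => γ.antitone (Nat.lt_succ_iff.mp j.2)

theorem exists_le_anovaComplexity_one : ∃ c : ℝ, 0 < c ∧ ∀ (K : ℕ) (ε : ℝ), K ≠ 0 → 0 < ε →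
    ε ^ 2 < c * (K : ℝ) ^ (-α) → K ≤ anovaComplexity α γ ε 1 := by
  classical
  obtain ⟨c, hc, h⟩ := exists_le_anovaWeight₁ hα.out
  refine ⟨γ 0 * c, mul_pos (γ.pos 0) hc, fun K ε hK hε hlt => ?_⟩
  have hinj : Function.Injective fun (k : ℕ) (_ : Fin 1) => k := fun k l h => congrFun h 0
  have hcard : ((Finset.Icc 1 K).image fun (k : ℕ) (_ : Fin 1) => k).card = K := by
    rw [Finset.card_image_of_injective _ hinj]
    simp
  rw [← hcard]
  refine card_le_anovaComplexity γ 1 hε _ fun i hi => ?_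
  obtain ⟨k, hk, rfl⟩ := Finset.mem_image.mp hi
  obtain ⟨hk1, hkK⟩ := Finset.mem_Icc.mp hk
  have hk0 : k ≠ 0 := by omega
  refine hlt.trans_le ?_
  simp only [anovaWeight, Fin.prod_univ_one, Fin.val_zero]
  rw [anovaWeight₁_eq_mul hk0, mul_assoc]
  refine mul_le_mul_of_nonneg_left (le_trans ?_ (h k hk0)) (γ.pos 0).le
  refine mul_le_mul_of_nonneg_left ?_ hc.le
  exact Real.rpow_le_rpow_of_nonpos (by exact_mod_cast hk1) (by exact_mod_cast hkK)
    (by linarith [hα.out])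

end Complexity

/-! ### Elementary estimates -/

theorem exists_mul_pow_le_choose {m : ℕ} (hm : m ≠ 0) :
    ∃ A : ℝ, 0 < A ∧ ∀ n : ℕ, m ≤ n → A * (n : ℝ) ^ m ≤ n.choose m := by
  have hm1 : (1 : ℝ) ≤ m := by exact_mod_cast Nat.one_le_iff_ne_zero.mpr hm
  refine ⟨1 / ((m : ℝ) ^ m * m.factorial), by positivity, fun n hn => ?_⟩
  -- Equivalent to `(m - 1)(n - m) ≥ 0`.
  have h1 : (n : ℝ) / m ≤ ((n + 1 - m : ℕ) : ℝ) := by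
    have hnm : (m : ℝ) ≤ n := by exact_mod_cast hn
    rw [Nat.cast_sub (by omega), div_le_iff₀ (by linarith)]
    push_cast
    nlinarith
  refine le_trans ?_ (Nat.pow_le_choose (α := ℝ) m n)
  calc 1 / ((m : ℝ) ^ m * m.factorial) * (n : ℝ) ^ m
      = ((n : ℝ) / m) ^ m / m.factorial := by rw [div_pow]; field_simp
    _ ≤ _ := by gcongr

theorem sqrt_mem_Ioo {x : ℝ} (h0 : 0 < x) (h1 : x < 1) : √x ∈ Set.Ioo (0 : ℝ) 1 :=
  ⟨Real.sqrt_pos.mpr h0, by rwa [Real.sqrt_lt' one_pos, one_pow]⟩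

theorem sqrt_rpow {x : ℝ} (hx : 0 ≤ x) (y : ℝ) : √x ^ y = x ^ (y / 2) := by
  rw [Real.sqrt_eq_rpow, ← Real.rpow_mul hx]
  congr 1
  ring

/-- At `s = 1` this turns a QPT bound into a polynomial one. -/
theorem exp_mul_one_add_log_inv {τ ε : ℝ} (hε : 0 < ε) :
    Real.exp (τ * (1 + Real.log ε⁻¹)) = Real.exp τ * ε ^ (-τ) := by
  rw [Real.rpow_def_of_pos hε, ← Real.exp_add, Real.log_inv]
  congr 1
  ring

theorem one_add_log_le {x p : ℝ} (hx : 1 ≤ x) (hp : 0 < p) :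
    1 + Real.log x ≤ (1 + 1 / p) * x ^ p := by
  have h1 := Real.log_le_rpow_div (by linarith : 0 ≤ x) hp
  have h2 := Real.one_le_rpow hx hp.le
  rw [add_mul, one_mul, one_div_mul_eq_div]
  linarith

theorem prod_one_add_mul_anovaZeta_le (α κ : ℝ) (γ : ProductWeights) (s : ℕ) :
    ∏ j : Fin s, (1 + γ j ^ κ * anovaZeta α κ)
      ≤ Real.exp ((∑ j : Fin s, γ j ^ κ) * anovaZeta α κ) := by
  rw [Finset.sum_mul]
  exact Real.prod_one_add_le_exp_sum _ fun j =>
    mul_nonneg (Real.rpow_nonneg (γ.pos _).le _) (anovaZeta_nonneg α κ)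

section Bounds

variable {α : ℝ} [hα : Fact (1 ≤ α)] {γ : ProductWeights}

/-! ### Polynomial bounds -/

theorem exists_anovaComplexity_le_rpow {κ : ℝ} (hκ : 1 / α < κ)
    (hγ : Summable fun j => γ j ^ κ) : ∃ C : ℝ, 0 < C ∧
    ∀ s : ℕ, 1 ≤ s → ∀ ε ∈ Set.Ioo (0 : ℝ) 1,
      (anovaComplexity α γ ε s : ℝ) ≤ C * ε ^ (-(2 * κ)) := by
  refine ⟨Real.exp ((∑' j, γ j ^ κ) * anovaZeta α κ), Real.exp_pos _, fun s _ ε hε => ?_⟩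
  refine (anovaComplexity_le γ s hε.1 hκ).trans ?_
  rw [mul_comm]
  refine mul_le_mul_of_nonneg_right ?_ (Real.rpow_nonneg hε.1.le _)
  refine (prod_one_add_mul_anovaZeta_le α κ γ s).trans ?_
  rw [Real.exp_le_exp]
  refine mul_le_mul_of_nonneg_right ?_ (anovaZeta_nonneg α κ)
  rw [Fin.sum_univ_eq_sum_range fun j => γ j ^ κ]
  exact hγ.sum_le_tsum _ fun j _ => Real.rpow_nonneg (γ.pos j).le _

/-- Taking `ε²` proportional to `K^(-α)` forces `K ≤ n(ε, 1)`, which is at most a constant times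
`K^(ατ/2)`. Letting `K → ∞` gives `ατ/2 ≥ 1`. -/
theorem one_div_le_of_anovaComplexity_le {C τ : ℝ}
    (h : ∀ ε ∈ Set.Ioo (0 : ℝ) 1, (anovaComplexity α γ ε 1 : ℝ) ≤ C * ε ^ (-τ)) :
    1 / α ≤ τ / 2 := by
  have hα0 : 0 < α := by linarith [hα.out]
  by_contra! hlt
  rw [lt_div_iff₀ hα0] at hlt
  obtain ⟨c, hc, hK⟩ := exists_le_anovaComplexity_one (α := α) γ
  -- Below `c` for the strict inequality in the counting bound, below 1 to keep `ε < 1`.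
  set d := min c 1 / 2 with hd
  have hd0 : 0 < d := by positivity
  have hdc : d < c := by
    have := min_le_left c 1
    rw [hd]
    linarith
  have hd1 : d < 1 := by
    have := min_le_right c 1
    rw [hd]
    linarith
  have hbound : ∀ K : ℕ, K ≠ 0 → (K : ℝ) ^ (1 - τ / 2 * α) ≤ C * d ^ (-τ / 2) := by
    intro K hK0
    have hK1 : (1 : ℝ) ≤ K := by exact_mod_cast Nat.one_le_iff_ne_zero.mpr hK0
    have hKp : (0 : ℝ) < (K : ℝ) ^ (-α) := by positivity
    have hx0 : 0 < d * (K : ℝ) ^ (-α) := by positivity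
    have hx1 : d * (K : ℝ) ^ (-α) < 1 := by
      have := Real.rpow_le_one_of_one_le_of_nonpos hK1 (by linarith : -α ≤ 0)
      nlinarith
    have h1 := hK K _ hK0 (Real.sqrt_pos.mpr hx0) (by
      rw [Real.sq_sqrt hx0.le]
      exact mul_lt_mul_of_pos_right hdc hKp)
    have h2 := (Nat.cast_le (α := ℝ).mpr h1).trans (h _ (sqrt_mem_Ioo hx0 hx1))
    rw [sqrt_rpow hx0.le, Real.mul_rpow hd0.le hKp.le, ← Real.rpow_mul (by linarith)] at h2
    rw [Real.rpow_sub (by linarith), Real.rpow_one, div_le_iff₀ (by positivity)]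
    calc (K : ℝ) ≤ _ := h2
      _ = _ := by
        rw [show -α * (-τ / 2) = τ / 2 * α by ring]
        ring
  have ht : Tendsto (fun K : ℕ => (K : ℝ) ^ (1 - τ / 2 * α)) atTop atTop :=
    (tendsto_rpow_atTop (by linarith)).comp tendsto_natCast_atTop_atTop
  obtain ⟨K, hK1, hK2⟩ := ((ht.eventually_gt_atTop (C * d ^ (-τ / 2))).and
    (eventually_ne_atTop 0)).exists
  exact absurd (hbound K hK2) (not_le.mpr hK1)

/-- Subsets of fixed size `m` and `ε² = γ_s^m / 2` give `γ_s^(mτ/2) = O(s^(σ-m))`; the condition on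
`κ` makes the resulting bound on `γ_s^κ` summable. Any `m > σ` serves for PT, while `m = 1`, `σ = 0`
gives the sharp range `κ > τ/2` for the SPT exponent. -/
theorem summable_rpow_of_anovaComplexity_le {C τ σ κ : ℝ} {m : ℕ} (hC : 0 ≤ C) (hτ : 0 < τ)
    (hσ : 0 ≤ σ) (hm : σ < m)
    (h : ∀ s : ℕ, 1 ≤ s → ∀ ε ∈ Set.Ioo (0 : ℝ) 1,
      (anovaComplexity α γ ε s : ℝ) ≤ C * ε ^ (-τ) * (s : ℝ) ^ σ)
    (hκ : m * τ < 2 * κ * (m - σ)) : Summable fun j => γ j ^ κ := by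
  have hm0 : (0 : ℝ) < m := hσ.trans_lt hm
  have hm0' : m ≠ 0 := by
    rintro rfl
    simp at hm0
  have hmτ : 0 < m * τ := mul_pos hm0 hτ
  have hκ0 : 0 < κ := by
    by_contra! hle
    nlinarith
  obtain ⟨A, hA, hchoose⟩ := exists_mul_pow_le_choose hm0'
  set D := C * 2 ^ (τ / 2) / A with hD
  have hD0 : 0 ≤ D := by positivity
  have hbound : ∀ s : ℕ, m ≤ s → γ s ^ κ
      ≤ D ^ (2 * κ / (m * τ)) * ((s + 1 : ℕ) : ℝ) ^ ((σ - m) * (2 * κ / (m * τ))) := by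
    intro s hs
    have hg := γ.pos s
    have hs0 : (0 : ℝ) < ((s + 1 : ℕ) : ℝ) := by positivity
    -- Halving gives `ε² < γ s ^ m` strictly and `ε < 1` even when `γ s = 1`.
    have hx0 : 0 < γ s ^ m / 2 := by positivity
    have hx1 : γ s ^ m / 2 < 1 := by
      have := pow_le_one₀ (n := m) hg.le (γ.le_one s)
      linarith
    have h1 := choose_le_anovaComplexity (α := α) γ s (Real.sqrt_pos.mpr hx0) (m := m) (by
      rw [Real.sq_sqrt hx0.le]
      linarith)
    have h2 := (hchoose (s + 1) (by omega)).trans ((Nat.cast_le (α := ℝ).mpr h1).trans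
      (h (s + 1) (by omega) _ (sqrt_mem_Ioo hx0 hx1)))
    rw [sqrt_rpow hx0.le, neg_div, Real.rpow_neg hx0.le, Real.div_rpow (by positivity) zero_le_two,
      ← Real.rpow_natCast (γ s) m, ← Real.rpow_mul hg.le, ← Real.rpow_natCast _ m] at h2
    have h3 : γ s ^ (m * (τ / 2)) ≤ D * ((s + 1 : ℕ) : ℝ) ^ (σ - m) := by
      rw [Real.rpow_sub hs0, hD, div_mul_div_comm, le_div_iff₀ (by positivity)]
      rw [inv_div, ← mul_div_assoc, div_mul_eq_mul_div, le_div_iff₀ (by positivity)] at h2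
      linarith
    have h4 := Real.rpow_le_rpow (by positivity) h3 (by positivity : 0 ≤ 2 * κ / (m * τ))
    rw [Real.mul_rpow hD0 (by positivity), ← Real.rpow_mul hg.le, ← Real.rpow_mul hs0.le] at h4
    rwa [show m * (τ / 2) * (2 * κ / (m * τ)) = κ by field_simp] at h4
  have hsum : Summable fun s : ℕ => D ^ (2 * κ / (m * τ)) *
      ((s + 1 : ℕ) : ℝ) ^ ((σ - m) * (2 * κ / (m * τ))) := by
    refine ((summable_nat_add_iff 1).mpr (Real.summable_nat_rpow.mpr ?_)).mul_left _
    rw [← mul_div_assoc, div_lt_iff₀ hmτ]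
    linarith
  refine hsum.of_norm_bounded_eventually_nat ?_
  filter_upwards [eventually_ge_atTop m] with s hs
  rw [Real.norm_of_nonneg (Real.rpow_nonneg (γ.pos s).le _)]
  exact hbound s hs

/-! ### Quasi-polynomial bounds -/

theorem weightInf_le (γ : ProductWeights) (j : ℕ) : weightInf γ ≤ γ j :=
  ciInf_le ⟨0, Set.forall_mem_range.mpr fun j => (γ.pos j).le⟩ j

theorem weightInf_nonneg (γ : ProductWeights) : 0 ≤ weightInf γ :=
  le_ciInf fun j => (γ.pos j).le

theorem weightInf_le_one (γ : ProductWeights) : weightInf γ ≤ 1 :=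
  (weightInf_le γ 0).trans (γ.le_one 0)

/-- The Markov bound is used with exponent `κ (1 + ln s)`. From some `j₀` on, `γ_j < e^(-1/κ)`, so
these factors have `γ_j` raised to that exponent at most `1/s` and together add at most 1; the first
`j₀` add at most `j₀`. The product is thus bounded uniformly in `s`. -/
theorem exists_anovaComplexity_le_exp {κ : ℝ} (hκ : 1 / α < κ)
    (hγ : weightInf γ < Real.exp (-κ⁻¹)) : ∃ C : ℝ, 0 < C ∧
    ∀ s : ℕ, 1 ≤ s → ∀ ε ∈ Set.Ioo (0 : ℝ) 1, (anovaComplexity α γ ε s : ℝ)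
      ≤ C * Real.exp (2 * κ * (1 + Real.log s) * (1 + Real.log ε⁻¹)) := by
  have hκ0 : 0 < κ := (one_div_pos.mpr (by linarith [hα.out])).trans hκ
  obtain ⟨j₀, hj₀⟩ := exists_lt_of_ciInf_lt hγ
  refine ⟨Real.exp ((j₀ + 1) * anovaZeta α κ), Real.exp_pos _, fun s hs ε hε => ?_⟩
  have hs1 : (1 : ℝ) ≤ s := by exact_mod_cast hs
  have hlog : 0 ≤ Real.log s := Real.log_nonneg hs1
  set κ' := κ * (1 + Real.log s) with hκ'
  have hle : κ ≤ κ' := by rw [hκ']; nlinarith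
  have hκ'0 : 0 < κ' := hκ0.trans_le hle
  have hpow : ∀ j : ℕ, γ j ^ κ' ≤ (if j < j₀ then 1 else 0) + 1 / (s : ℝ) := by
    intro j
    have hj := γ.pos j
    split_ifs with h
    · have := Real.rpow_le_one hj.le (γ.le_one j) hκ'0.le
      have : (0 : ℝ) < 1 / s := by positivity
      linarith
    · calc γ j ^ κ' ≤ Real.exp (-κ⁻¹) ^ κ' :=
          Real.rpow_le_rpow hj.le ((γ.antitone (not_lt.mp h)).trans hj₀.le) hκ'0.le
        _ = Real.exp (-(1 + Real.log s)) := by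
          rw [← Real.exp_mul, hκ']
          congr 1
          field_simp
        _ ≤ Real.exp (-Real.log s) := Real.exp_le_exp.mpr (by linarith)
        _ = 0 + 1 / (s : ℝ) := by
          rw [Real.exp_neg, Real.exp_log (by linarith)]
          ring
  have hsum : ∑ j : Fin s, γ j ^ κ' ≤ j₀ + 1 := by
    rw [Fin.sum_univ_eq_sum_range fun j => γ j ^ κ']
    refine (Finset.sum_le_sum fun j _ => hpow j).trans ?_
    rw [Finset.sum_add_distrib, Finset.sum_const, Finset.card_range, nsmul_eq_mul,
      mul_one_div_cancel (by linarith), ← Finset.sum_filter, Finset.sum_const, nsmul_eq_mul, mul_one]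
    have : ((Finset.range s).filter (· < j₀)).card ≤ j₀ := by
      calc _ ≤ (Finset.range j₀).card :=
            Finset.card_le_card fun j hj => by simp at hj ⊢; exact hj.2
        _ = j₀ := Finset.card_range _
    have : (((Finset.range s).filter (· < j₀)).card : ℝ) ≤ j₀ := by exact_mod_cast this
    linarith
  refine (anovaComplexity_le γ s hε.1 (hκ.trans_le hle)).trans ?_
  rw [mul_comm]
  refine mul_le_mul ?_ ?_ (Real.rpow_nonneg hε.1.le _) (Real.exp_pos _).le
  · refine (prod_one_add_mul_anovaZeta_le α κ' γ s).trans ?_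
    rw [Real.exp_le_exp]
    exact mul_le_mul hsum (anovaZeta_anti hα.out hκ hle) (anovaZeta_nonneg _ _) (by positivity)
  · rw [Real.rpow_def_of_pos hε.1, Real.exp_le_exp, Real.log_inv, hκ']
    have : 0 ≤ κ * (1 + Real.log s) := hκ'0.le
    linarith

theorem one_le_of_anovaComplexity_le_exp {C τ : ℝ} (hC : 0 < C) (hτ : 0 ≤ τ)
    (h : ∀ s : ℕ, 1 ≤ s → ∀ ε ∈ Set.Ioo (0 : ℝ) 1, (anovaComplexity α γ ε s : ℝ)
      ≤ C * Real.exp (τ * (1 + Real.log s) * (1 + Real.log ε⁻¹)))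
    (hγ : 0 < weightInf γ) : 1 ≤ τ / 2 * Real.log (weightInf γ)⁻¹ := by
  set g := weightInf γ with hg
  -- For fixed `m` and `ε² = g^m / 2`, the binomial bound grows like `s^m` and the QPT bound like
  -- `s^(τ(1 + ln ε⁻¹))`; the exponents are compared as `s → ∞`.
  have key : ∀ m : ℕ, m ≠ 0 →
      (m : ℝ) ≤ τ * (1 + (m * Real.log g⁻¹ + Real.log 2) / 2) := by
    intro m hm
    obtain ⟨A, hA, hchoose⟩ := exists_mul_pow_le_choose hm
    set E := 1 + (m * Real.log g⁻¹ + Real.log 2) / 2 with hE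
    have hx0 : 0 < g ^ m / 2 := by positivity
    have hx1 : g ^ m / 2 < 1 := by
      have := pow_le_one₀ (n := m) hγ.le (weightInf_le_one γ)
      linarith
    have hEε : 1 + Real.log (√(g ^ m / 2))⁻¹ = E := by
      rw [Real.log_inv, Real.log_sqrt hx0.le, Real.log_div (by positivity) two_ne_zero,
        Real.log_pow, hE, Real.log_inv]
      ring
    have hbound : ∀ s : ℕ, m ≤ s →
        (m - τ * E) * Real.log ((s + 1 : ℕ) : ℝ) ≤ Real.log C + τ * E - Real.log A := by
      intro s hs
      have hs0 : (0 : ℝ) < ((s + 1 : ℕ) : ℝ) := by positivity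
      have h1 := choose_le_anovaComplexity (α := α) γ s (Real.sqrt_pos.mpr hx0) (m := m) (by
        rw [Real.sq_sqrt hx0.le]
        have := pow_le_pow_left₀ hγ.le (weightInf_le γ s) m
        have : 0 < g ^ m := by positivity
        linarith)
      have h2 := (hchoose (s + 1) (by omega)).trans ((Nat.cast_le (α := ℝ).mpr h1).trans
        (h (s + 1) (by omega) _ (sqrt_mem_Ioo hx0 hx1)))
      have h3 := Real.log_le_log (by positivity) h2
      rw [hEε, Real.log_mul hA.ne' (by positivity), Real.log_pow,
        Real.log_mul hC.ne' (Real.exp_pos _).ne', Real.log_exp] at h3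
      linarith
    by_contra! hlt
    have ht : Tendsto (fun s : ℕ => (m - τ * E) * Real.log ((s + 1 : ℕ) : ℝ)) atTop atTop :=
      (Real.tendsto_log_atTop.comp (tendsto_natCast_atTop_atTop.comp
        (tendsto_add_atTop_nat 1))).const_mul_atTop (by linarith)
    obtain ⟨s, hs1, hs2⟩ := ((ht.eventually_gt_atTop (Real.log C + τ * E - Real.log A)).and
      (eventually_ge_atTop m)).exists
    exact absurd (hbound s hs2) (not_le.mpr hs1)
  by_contra! hlt
  -- Dividing `key` by `m` and letting `m → ∞` leaves `1 ≤ τ/2 * ln g⁻¹`; this `m` is large enough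
  -- to contradict its failure.
  obtain ⟨m, hm⟩ := exists_nat_gt (τ * (1 + Real.log 2 / 2) / (1 - τ / 2 * Real.log g⁻¹))
  rw [div_lt_iff₀ (by linarith)] at hm
  have hm0 : m ≠ 0 := by
    rintro rfl
    have : 0 ≤ τ * (1 + Real.log 2 / 2) := by positivity
    simp at hm
    linarith
  have := key m hm0
  linarith

end Bounds

/-! ### Weak tractability -/

section Weak

variable {n : ℝ → ℕ → ℕ}

theorem tendsto_limitFilter_atTop {σ τ : ℝ} (hσ : 0 < σ) (hτ : 0 < τ) :
    Tendsto (fun p : ℝ × ℕ => (p.2 : ℝ) ^ σ + p.1 ^ (-τ)) limitFilter atTop := by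
  -- Both bases are at least 1, so lowering the exponents to `ρ` only decreases the sum, and the
  -- larger base is at least half of `s + ε⁻¹`.
  set ρ := min σ τ with hρ
  have hρ0 : 0 < ρ := lt_min hσ hτ
  have h1 : Tendsto (fun p : ℝ × ℕ => (p.2 : ℝ) + p.1⁻¹) limitFilter atTop :=
    tendsto_comap.mono_left inf_le_left
  have h2 : Tendsto (fun p : ℝ × ℕ => (((p.2 : ℝ) + p.1⁻¹) / 2) ^ ρ) limitFilter atTop :=
    (tendsto_rpow_atTop hρ0).comp (h1.atTop_div_const two_pos)
  refine tendsto_atTop_mono' _ ?_ h2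
  filter_upwards [mem_inf_of_right (mem_principal_self _)] with p hp
  obtain ⟨⟨hε0, hε1⟩, hs⟩ := hp
  have hs1 : (1 : ℝ) ≤ p.2 := by exact_mod_cast hs
  have he1 : 1 ≤ p.1⁻¹ := (one_le_inv₀ hε0).mpr hε1.le
  have ha : (p.2 : ℝ) ^ ρ ≤ (p.2 : ℝ) ^ σ := Real.rpow_le_rpow_of_exponent_le hs1 (min_le_left _ _)
  have hb : p.1⁻¹ ^ ρ ≤ p.1 ^ (-τ) := by
    rw [Real.rpow_neg hε0.le, ← Real.inv_rpow hε0.le]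
    exact Real.rpow_le_rpow_of_exponent_le he1 (min_le_right _ _)
  have hpa : 0 ≤ (p.2 : ℝ) ^ ρ := by positivity
  have hpb : 0 ≤ p.1⁻¹ ^ ρ := by positivity
  rcases le_total (p.2 : ℝ) p.1⁻¹ with h | h
  · have := Real.rpow_le_rpow (by linarith) (by linarith : ((p.2 : ℝ) + p.1⁻¹) / 2 ≤ p.1⁻¹) hρ0.le
    linarith
  · have := Real.rpow_le_rpow (by linarith) (by linarith : ((p.2 : ℝ) + p.1⁻¹) / 2 ≤ p.2) hρ0.le
    linarith

theorem weakTractability_of_log_le {σ τ θ C : ℝ} (hσ : 0 < σ) (hτ : 0 < τ) (hθ : θ < 1)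
    (h : ∀ s : ℕ, 1 ≤ s → ∀ ε ∈ Set.Ioo (0 : ℝ) 1,
      Real.log (n ε s) ≤ C * ((s : ℝ) ^ σ + ε ^ (-τ)) ^ θ) : WeakTractability n σ τ := by
  have hlim : Tendsto (fun p : ℝ × ℕ => C * ((p.2 : ℝ) ^ σ + p.1 ^ (-τ)) ^ (-(1 - θ)))
      limitFilter (𝓝 0) := by
    simpa using ((tendsto_rpow_neg_atTop (by linarith : 0 < 1 - θ)).comp
      (tendsto_limitFilter_atTop hσ hτ)).const_mul C
  have hpos : ∀ᶠ p : ℝ × ℕ in limitFilter, 0 < (p.2 : ℝ) ^ σ + p.1 ^ (-τ) :=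
    (tendsto_limitFilter_atTop hσ hτ).eventually_gt_atTop 0
  refine squeeze_zero' ?_ ?_ hlim
  · filter_upwards [hpos] with p hp
    exact div_nonneg (Real.log_natCast_nonneg _) hp.le
  · filter_upwards [hpos, mem_inf_of_right (mem_principal_self _)] with p hp hp2
    rw [div_le_iff₀ hp, mul_assoc, ← Real.rpow_add_one hp.ne',
      show -(1 - θ) + 1 = θ by ring]
    exact h p.2 hp2.2 p.1 hp2.1

/-- With `D = s^σ + ε^(-τ)`, each of the factors `1 + ln s` and `1 + ln ε⁻¹` is `O(D^(1/4))`, so `ln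
n = O(D^(1/2))`. -/
theorem QPT.uwt (h : QPT n) : UWT n := by
  obtain ⟨τ₀, C, hτ₀, hC, h⟩ := h
  intro σ hσ τ hτ
  have hσ0 := hσ.1
  have hτ0 := hτ.1
  refine weakTractability_of_log_le (θ := 1 / 2)
    (C := Real.log (C + 1) + τ₀ * (1 + 1 / (σ / 4)) * (1 + 1 / (τ / 4))) hσ0 hτ0 (by norm_num)
    fun s hs ε hε => ?_
  have hs1 : (1 : ℝ) ≤ s := by exact_mod_cast hs
  have he1 : 1 ≤ ε⁻¹ := (one_le_inv₀ hε.1).mpr hε.2.le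
  set D := (s : ℝ) ^ σ + ε ^ (-τ) with hD
  have hsσ : 1 ≤ (s : ℝ) ^ σ := Real.one_le_rpow hs1 hσ0.le
  have hετ : 0 ≤ ε ^ (-τ) := Real.rpow_nonneg hε.1.le _
  have hD1 : 1 ≤ D := by linarith
  have hlogC : 0 ≤ Real.log (C + 1) := Real.log_nonneg (by linarith)
  have hls : 0 ≤ Real.log s := Real.log_nonneg hs1
  have hle : 0 ≤ Real.log ε⁻¹ := Real.log_nonneg he1
  have ha : (s : ℝ) ^ (σ / 4) ≤ D ^ (1 / 4 : ℝ) := by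
    rw [show σ / 4 = σ * (1 / 4) by ring, Real.rpow_mul (by linarith)]
    exact Real.rpow_le_rpow (by linarith) (by linarith) (by norm_num)
  have hb : ε⁻¹ ^ (τ / 4) ≤ D ^ (1 / 4 : ℝ) := by
    rw [show τ / 4 = τ * (1 / 4) by ring, Real.rpow_mul (by linarith), Real.inv_rpow hε.1.le,
      ← Real.rpow_neg hε.1.le]
    exact Real.rpow_le_rpow hετ (by linarith) (by norm_num)
  have h1 := (one_add_log_le hs1 (by positivity : 0 < σ / 4)).trans
    (mul_le_mul_of_nonneg_left ha (by positivity))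
  have h2 := (one_add_log_le he1 (by positivity : 0 < τ / 4)).trans
    (mul_le_mul_of_nonneg_left hb (by positivity))
  have h3 := mul_le_mul h1 h2 (by linarith) (by positivity)
  have hDD : D ^ (1 / 4 : ℝ) * D ^ (1 / 4 : ℝ) = D ^ (1 / 2 : ℝ) := by
    rw [← Real.rpow_add (by linarith)]
    norm_num
  have hD2 : 1 ≤ D ^ (1 / 2 : ℝ) := Real.one_le_rpow hD1 (by norm_num)
  have h4 : Real.log (n ε s)
      ≤ Real.log (C + 1) + τ₀ * ((1 + Real.log s) * (1 + Real.log ε⁻¹)) := by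
    -- For `n = 0` the convention `log 0 = 0` suffices. Passing from `C` to `C + 1` keeps the
    -- logarithm of the constant nonnegative, as `C` may vanish.
    rcases Nat.eq_zero_or_pos (n ε s) with h0 | h0
    · rw [h0, Nat.cast_zero, Real.log_zero]
      positivity
    · have h5 := (h s hs ε hε).trans (mul_le_mul_of_nonneg_right
        (by linarith : C ≤ C + 1) (Real.exp_pos _).le)
      have h6 := Real.log_le_log (by exact_mod_cast h0) h5
      rw [Real.log_mul (by linarith) (Real.exp_pos _).ne', Real.log_exp] at h6
      linarith
  have h7 := mul_le_mul_of_nonneg_left h3 hτ₀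
  have h8 := mul_le_mul_of_nonneg_left hD2 hlogC
  calc Real.log (n ε s) ≤ _ := h4
    _ ≤ Real.log (C + 1) * D ^ (1 / 2 : ℝ) + τ₀ * ((1 + 1 / (σ / 4)) * D ^ (1 / 4 : ℝ) *
        ((1 + 1 / (τ / 4)) * D ^ (1 / 4 : ℝ))) := by linarith
    _ = _ := by rw [← hDD]; ring

theorem UWT.wt (h : UWT n) : WT n := by
  have := h 1 ⟨one_pos, le_rfl⟩ 1 ⟨one_pos, le_rfl⟩
  simpa only [WT, WeakTractability, Real.rpow_one, Real.rpow_neg_one] using this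

end Weak

/-! ### Weak tractability of the Gaussian ANOVA space -/

section Bounds

variable {α : ℝ} [hα : Fact (1 ≤ α)] {γ : ProductWeights}

theorem weightInf_lt_one_of_wt (h : WT (anovaComplexity α γ)) : weightInf γ < 1 := by
  by_contra! hle
  have hγ : ∀ j, γ j = 1 := fun j => le_antisymm (γ.le_one j) (hle.trans (weightInf_le γ j))
  have h2 : ∀ s : ℕ, 2 ^ s ≤ anovaComplexity α γ (1 / 2) s := by
    intro s
    have := card_subsets_le_anovaComplexity (α := α) γ s (ε := 1 / 2) (by norm_num)
      (Finset.univ : Finset (Finset (Fin s))) fun A _ => by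
        simp only [hγ, Finset.prod_const_one]
        norm_num
    simpa using this
  have ht : Tendsto (fun s : ℕ => ((1 / 2 : ℝ), s + 1)) atTop limitFilter := by
    refine tendsto_inf.mpr ⟨tendsto_comap_iff.mpr ?_, tendsto_principal.mpr
      (Eventually.of_forall fun s => ⟨⟨by norm_num, by norm_num⟩, by simp⟩)⟩
    exact tendsto_atTop_add_const_right _ (1 / 2 : ℝ)⁻¹
      ((tendsto_natCast_atTop_atTop (R := ℝ)).comp (tendsto_add_atTop_nat 1))
  have hlim := h.comp ht
  have hlog : 0 < Real.log 2 := Real.log_pos one_lt_two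
  -- The quotient is at least `(s + 1) ln 2 / (s + 3)`, hence at least `ln 2 / 3`.
  obtain ⟨s, hs⟩ := (hlim.eventually (gt_mem_nhds (by positivity : 0 < Real.log 2 / 3))).exists
  refine absurd hs (not_lt.mpr ?_)
  have h3 : (2 : ℝ) ^ (s + 1) ≤ anovaComplexity α γ (1 / 2) (s + 1) := by
    exact_mod_cast h2 (s + 1)
  have h4 := Real.log_le_log (by positivity) h3
  rw [Real.log_pow] at h4
  have h5 : (0 : ℝ) < ((s + 1 : ℕ) : ℝ) + (1 / 2 : ℝ)⁻¹ := by positivity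
  simp only [Function.comp]
  rw [le_div_iff₀ h5]
  refine le_trans ?_ h4
  push_cast
  have : (0 : ℝ) ≤ s := s.cast_nonneg
  nlinarith

theorem weakTractability_of_one_lt {σ τ : ℝ} (hσ : 1 < σ) (hτ : 0 < τ) :
    WeakTractability (anovaComplexity α γ) σ τ := by
  have hκ : 1 / α < 2 := by
    rw [div_lt_iff₀ (by linarith [hα.out])]
    linarith [hα.out]
  have hσ0 : 0 < σ := by linarith
  set Z := anovaZeta α 2
  have hZ : 0 ≤ Z := anovaZeta_nonneg α 2
  -- `1/σ` absorbs the linear term in `s`, where `σ > 1` is essential; `1/2` absorbs `ln ε⁻¹`.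
  refine weakTractability_of_log_le (θ := max (1 / 2) (1 / σ))
    (C := 4 * (1 + 1 / (τ / 2)) + Z) hσ0 hτ
    (max_lt (by norm_num) (by rwa [div_lt_one hσ0])) fun s hs ε hε => ?_
  have hs1 : (1 : ℝ) ≤ s := by exact_mod_cast hs
  have he1 : 1 ≤ ε⁻¹ := (one_le_inv₀ hε.1).mpr hε.2.le
  set D := (s : ℝ) ^ σ + ε ^ (-τ) with hD
  have hsσ : 1 ≤ (s : ℝ) ^ σ := Real.one_le_rpow hs1 hσ0.le
  have hετ : 0 ≤ ε ^ (-τ) := Real.rpow_nonneg hε.1.le _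
  have hD1 : 1 ≤ D := by linarith
  have ha : (s : ℝ) ≤ D ^ max (1 / 2) (1 / σ) := by
    calc (s : ℝ) = ((s : ℝ) ^ σ) ^ (1 / σ) := by
          rw [← Real.rpow_mul (by linarith), mul_one_div_cancel hσ0.ne', Real.rpow_one]
      _ ≤ D ^ (1 / σ) := Real.rpow_le_rpow (by linarith) (by linarith) (by positivity)
      _ ≤ _ := Real.rpow_le_rpow_of_exponent_le hD1 (le_max_right _ _)
  have hb : ε⁻¹ ^ (τ / 2) ≤ D ^ max (1 / 2) (1 / σ) := by
    calc ε⁻¹ ^ (τ / 2) = (ε ^ (-τ)) ^ (1 / 2 : ℝ) := by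
          rw [show τ / 2 = τ * (1 / 2) by ring, Real.rpow_mul (by linarith),
            Real.inv_rpow hε.1.le, ← Real.rpow_neg hε.1.le]
      _ ≤ D ^ (1 / 2 : ℝ) := Real.rpow_le_rpow hετ (by linarith) (by norm_num)
      _ ≤ _ := Real.rpow_le_rpow_of_exponent_le hD1 (le_max_left _ _)
  have h1 : Real.log (anovaComplexity α γ ε s) ≤ 4 * Real.log ε⁻¹ + Z * s := by
    rcases Nat.eq_zero_or_pos (anovaComplexity α γ ε s) with h0 | h0
    · rw [h0, Nat.cast_zero, Real.log_zero]
      have := Real.log_nonneg he1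
      positivity
    · have h2 : (anovaComplexity α γ ε s : ℝ) ≤ ε ^ (-(2 * 2 : ℝ)) * Real.exp (Z * s) := by
        refine (anovaComplexity_le γ s hε.1 hκ).trans
          (mul_le_mul_of_nonneg_left ?_ (Real.rpow_nonneg hε.1.le _))
        refine (prod_one_add_mul_anovaZeta_le α 2 γ s).trans ?_
        rw [Real.exp_le_exp, Finset.sum_mul]
        calc ∑ j : Fin s, γ j ^ (2 : ℝ) * Z ≤ ∑ j : Fin s, 1 * Z :=
              Finset.sum_le_sum fun j _ => mul_le_mul_of_nonneg_right
                (Real.rpow_le_one (γ.pos j).le (γ.le_one j) zero_le_two) hZ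
          _ = Z * s := by simp [mul_comm]
      have h3 := Real.log_le_log (by exact_mod_cast h0) h2
      rw [Real.log_mul (Real.rpow_pos_of_pos hε.1 _).ne' (Real.exp_pos _).ne', Real.log_exp,
        Real.log_rpow hε.1] at h3
      rw [Real.log_inv]
      linarith
  have h2 := (one_add_log_le he1 (by positivity : 0 < τ / 2)).trans
    (mul_le_mul_of_nonneg_left hb (by positivity))
  have h3 := mul_le_mul_of_nonneg_left ha hZ
  linarith

end Bounds

/-! ### Characterizations of tractability -/

section SumExponent

variable {γ : ProductWeights}

theorem ProductWeights.summable_rpow_mono {κ κ' : ℝ} (h : Summable fun j => γ j ^ κ)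
    (hκ : κ ≤ κ') : Summable fun j => γ j ^ κ' :=
  h.of_nonneg_of_le (fun j => Real.rpow_nonneg (γ.pos j).le _) fun j =>
    Real.rpow_le_rpow_of_exponent_ge (γ.pos j) (γ.le_one j) hκ

theorem sumExponent_le {κ : ℝ} (hκ : 0 < κ) (h : Summable fun j => γ j ^ κ) :
    sumExponent γ ≤ ENNReal.ofReal κ :=
  iInf_le_of_le κ (iInf_le_of_le hκ (iInf_le _ h))

theorem summable_of_sumExponent_lt {κ : ℝ} (h : sumExponent γ < ENNReal.ofReal κ) :
    Summable fun j => γ j ^ κ := by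
  simp only [sumExponent, iInf_lt_iff] at h
  obtain ⟨κ', hκ', hs, hlt⟩ := h
  exact ProductWeights.summable_rpow_mono hs (ENNReal.ofReal_lt_ofReal_iff'.mp hlt).1.le

theorem sumExponent_lt_top_iff :
    sumExponent γ < ⊤ ↔ ∃ κ : ℝ, 0 < κ ∧ Summable fun j => γ j ^ κ := by
  simp [sumExponent, iInf_lt_iff]

end SumExponent

theorem SPT.pt {n : ℝ → ℕ → ℕ} (h : SPT n) : PT n := by
  obtain ⟨τ, C, hτ, hC, h⟩ := h
  exact ⟨τ, 0, C, hτ, le_rfl, hC, fun s hs ε hε => by simpa using h s hs ε hε⟩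

/-! ### The equivalences and exponents for the Gaussian ANOVA space -/

section Anova

variable {α : ℝ} [hα : Fact (1 ≤ α)] {γ : ProductWeights}

theorem sumExponent_lt_top_of_pt (h : PT (anovaComplexity α γ)) : sumExponent γ < ⊤ := by
  obtain ⟨τ, σ, C, hτ, hσ, hC, h⟩ := h
  obtain ⟨m, hm⟩ := exists_nat_gt σ
  have hm0 : (0 : ℝ) < m := hσ.trans_lt hm
  have hmσ : 0 < m - σ := by linarith
  have hpos : 0 < m * (τ + 1) / (m - σ) := by positivity
  -- Twice the critical exponent; `τ + 1` replaces `τ` because a positive exponent is needed.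
  refine sumExponent_lt_top_iff.mpr ⟨m * (τ + 1) / (m - σ), hpos,
    summable_rpow_of_anovaComplexity_le (τ := τ + 1) hC (by linarith) hσ hm
      (fun s hs ε hε => (h s hs ε hε).trans ?_) ?_⟩
  · have := Real.rpow_le_rpow_of_exponent_ge hε.1 hε.2.le (by linarith : -(τ + 1) ≤ -τ)
    gcongr
  · rw [mul_assoc, div_mul_cancel₀ _ hmσ.ne']
    have : 0 < m * (τ + 1) := by positivity
    linarith

theorem exists_bound_of_sumExponent_lt {κ : ℝ} (hκ : 1 / α < κ)
    (h : sumExponent γ < ENNReal.ofReal κ) : ∃ C : ℝ, 0 < C ∧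
    ∀ s : ℕ, 1 ≤ s → ∀ ε ∈ Set.Ioo (0 : ℝ) 1,
      (anovaComplexity α γ ε s : ℝ) ≤ C * ε ^ (-(2 * κ)) :=
  exists_anovaComplexity_le_rpow hκ (summable_of_sumExponent_lt h)

theorem exists_sumExponent_lt_ofReal (h : sumExponent γ < ⊤) {κ : ℝ}
    (hκ : (sumExponent γ).toReal < κ) : sumExponent γ < ENNReal.ofReal κ :=
  (ENNReal.lt_ofReal_iff_toReal_lt h.ne).mpr hκ

theorem spt_of_sumExponent_lt_top (h : sumExponent γ < ⊤) : SPT (anovaComplexity α γ) := by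
  set κ := max (1 / α) (sumExponent γ).toReal + 1 with hκ
  have h1 : 1 / α < κ := by linarith [le_max_left (1 / α) (sumExponent γ).toReal]
  have h2 : (sumExponent γ).toReal < κ := by
    linarith [le_max_right (1 / α) (sumExponent γ).toReal]
  obtain ⟨C, hC, hb⟩ := exists_bound_of_sumExponent_lt h1 (exists_sumExponent_lt_ofReal h h2)
  have h0 : 0 ≤ (sumExponent γ).toReal := ENNReal.toReal_nonneg
  exact ⟨2 * κ, C, by linarith, hC.le, hb⟩

theorem spt_iff : SPT (anovaComplexity α γ) ↔ sumExponent γ < ⊤ :=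
  ⟨fun h => sumExponent_lt_top_of_pt h.pt, spt_of_sumExponent_lt_top⟩

theorem sptExponent_eq (h : sumExponent γ < ⊤) :
    sptExponent (anovaComplexity α γ) = 2 * max (1 / α) (sumExponent γ).toReal := by
  set M := max (1 / α) (sumExponent γ).toReal with hM
  have hα0 : 0 < 1 / α := one_div_pos.mpr (by linarith [hα.out])
  have hmem : ∀ δ : ℝ, 0 < δ → 2 * (M + δ) ∈ {τ : ℝ | 0 ≤ τ ∧ ∃ C : ℝ, 0 < C ∧
      ∀ s : ℕ, 1 ≤ s → ∀ ε ∈ Set.Ioo (0 : ℝ) 1,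
        (anovaComplexity α γ ε s : ℝ) ≤ C * ε ^ (-τ)} := by
    intro δ hδ
    have h1 : 1 / α < M + δ := by linarith [le_max_left (1 / α) (sumExponent γ).toReal]
    have h2 : (sumExponent γ).toReal < M + δ := by
      linarith [le_max_right (1 / α) (sumExponent γ).toReal]
    exact ⟨by linarith, exists_bound_of_sumExponent_lt h1 (exists_sumExponent_lt_ofReal h h2)⟩
  refine le_antisymm (le_of_forall_pos_le_add fun δ hδ => ?_)
    (le_csInf ⟨_, hmem 1 one_pos⟩ ?_)
  · refine (csInf_le ⟨0, fun τ hτ => hτ.1⟩ (hmem (δ / 2) (by linarith))).trans_eq ?_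
    ring
  · rintro τ ⟨-, C, hC, hb⟩
    have h1 : 1 / α ≤ τ / 2 := one_div_le_of_anovaComplexity_le (hb 1 le_rfl)
    have h2 : (sumExponent γ).toReal ≤ τ / 2 := by
      -- Every `κ > τ/2` makes the weights summable, so `s_γ` is at most each such `κ`.
      refine le_of_forall_gt_imp_ge_of_dense fun κ hκ => ?_
      have hs : Summable fun j => γ j ^ κ :=
        summable_rpow_of_anovaComplexity_le (α := α) (τ := τ) (m := 1) (σ := 0) hC.le (by linarith) le_rfl
          (by norm_num) (fun s hs ε hε => by simpa using hb s hs ε hε)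
          (by push_cast; linarith)
      exact ENNReal.toReal_le_of_le_ofReal (by linarith) (sumExponent_le (by linarith) hs)
    linarith [max_le h1 h2]

theorem qpt_of_weightInf_lt_one (h : weightInf γ < 1) : QPT (anovaComplexity α γ) := by
  have hlim : Tendsto (fun κ : ℝ => Real.exp (-κ⁻¹)) atTop (𝓝 1) := by
    have := (Real.continuous_exp.tendsto _).comp (tendsto_inv_atTop_zero (𝕜 := ℝ)).neg
    simpa [Function.comp_def] using this
  -- Since `e^(-1/κ) → 1`, a large `κ` lifts the threshold above `γ_I`.
  obtain ⟨κ, hκ1, hκ2⟩ :=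
    ((hlim.eventually (lt_mem_nhds h)).and (eventually_gt_atTop (1 / α))).exists
  have hκ0 : 0 < κ := (one_div_pos.mpr (by linarith [hα.out])).trans hκ2
  obtain ⟨C, hC, hb⟩ := exists_anovaComplexity_le_exp hκ2 hκ1
  exact ⟨2 * κ, C, by linarith, hC.le, hb⟩

theorem qptExponent_eq (h : weightInf γ < 1) :
    qptExponent (anovaComplexity α γ) = if weightInf γ = 0 then 2 * (1 / α)
      else 2 * max (1 / α) (1 / Real.log (weightInf γ)⁻¹) := by
  set M := if weightInf γ = 0 then 1 / α else max (1 / α) (1 / Real.log (weightInf γ)⁻¹) with hM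
  have hα0 : 0 < 1 / α := one_div_pos.mpr (by linarith [hα.out])
  have hαM : 1 / α ≤ M := by
    rw [hM]
    split_ifs
    exacts [le_rfl, le_max_left _ _]
  have hlog : weightInf γ ≠ 0 → 0 < Real.log (weightInf γ)⁻¹ := fun h0 =>
    Real.log_pos ((one_lt_inv₀ ((weightInf_nonneg γ).lt_of_ne' h0)).mpr h)
  have hmem : ∀ δ : ℝ, 0 < δ → 2 * (M + δ) ∈ {τ : ℝ | 0 ≤ τ ∧ ∃ C : ℝ, 0 < C ∧
      ∀ s : ℕ, 1 ≤ s → ∀ ε ∈ Set.Ioo (0 : ℝ) 1, (anovaComplexity α γ ε s : ℝ)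
        ≤ C * Real.exp (τ * (1 + Real.log s) * (1 + Real.log ε⁻¹))} := by
    intro δ hδ
    refine ⟨by linarith, exists_anovaComplexity_le_exp (by linarith) ?_⟩
    by_cases h0 : weightInf γ = 0
    · rw [h0]
      exact Real.exp_pos _
    · have hl := hlog h0
      have hM' : 1 / Real.log (weightInf γ)⁻¹ < M + δ := by
        have := le_max_right (1 / α) (1 / Real.log (weightInf γ)⁻¹)
        rw [hM, if_neg h0]
        linarith
      -- The threshold `γ_I < e^(-1/κ)` is equivalent to `κ > 1/ln γ_I⁻¹`, the source of the second
      -- term in the exponent.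
      rw [← Real.log_lt_iff_lt_exp ((weightInf_nonneg γ).lt_of_ne' h0)]
      have h1 := inv_lt_of_inv_lt₀ hl (by rwa [one_div] at hM')
      rw [Real.log_inv] at h1
      linarith
  have hgoal : qptExponent (anovaComplexity α γ) = 2 * M := by
    refine le_antisymm (le_of_forall_pos_le_add fun δ hδ => ?_)
      (le_csInf ⟨_, hmem 1 one_pos⟩ ?_)
    · refine (csInf_le ⟨0, fun τ hτ => hτ.1⟩ (hmem (δ / 2) (by linarith))).trans_eq ?_
      ring
    · rintro τ ⟨hτ, C, hC, hb⟩
      have h1 : 1 / α ≤ τ / 2 := by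
        refine one_div_le_of_anovaComplexity_le (γ := γ) (C := C * Real.exp τ) fun ε hε => ?_
        have := hb 1 le_rfl ε hε
        rwa [Nat.cast_one, Real.log_one, add_zero, mul_one, exp_mul_one_add_log_inv hε.1,
          ← mul_assoc] at this
      have h2 : M ≤ τ / 2 := by
        rw [hM]
        split_ifs with h0
        · exact h1
        · refine max_le h1 ((div_le_iff₀ (hlog h0)).mpr ?_)
          exact one_le_of_anovaComplexity_le_exp hC hτ hb ((weightInf_nonneg γ).lt_of_ne' h0)
      linarith
  rw [hgoal, hM]
  split_ifs <;> rfl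

end Anova

end HermiteTractability

theorem theorem4p1 (α : ℝ) [Fact (1 ≤ α)] (γ : ProductWeights) :
    -- the minimum in the definition of the information complexity exists
    (∀ s : ℕ, 1 ≤ s → ∀ ε ∈ Set.Ioo (0 : ℝ) 1,
      ∃ n : ℕ, minimalError (anovaWeight α γ s) n ≤ ENNReal.ofReal ε) ∧
    -- strong polynomial tractability and its exponent
    (SPT (anovaComplexity α γ) ↔ sumExponent γ < ⊤) ∧
    (sumExponent γ < ⊤ →
      sptExponent (anovaComplexity α γ) = 2 * max (1 / α) (sumExponent γ).toReal) ∧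
    -- polynomial tractability
    (SPT (anovaComplexity α γ) ↔ PT (anovaComplexity α γ)) ∧
    -- quasi-polynomial, uniform weak and weak tractability
    (QPT (anovaComplexity α γ) ↔ weightInf γ < 1) ∧
    (UWT (anovaComplexity α γ) ↔ weightInf γ < 1) ∧
    (WT (anovaComplexity α γ) ↔ weightInf γ < 1) ∧
    (weightInf γ < 1 →
      qptExponent (anovaComplexity α γ) =
        if weightInf γ = 0 then 2 * (1 / α)
        else 2 * max (1 / α) (1 / Real.log (weightInf γ)⁻¹)) ∧
    -- weak tractability with parameters `σ > 1` and `τ > 0`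
    (∀ σ τ : ℝ, 1 < σ → 0 < τ → WeakTractability (anovaComplexity α γ) σ τ) :=
  ⟨fun s _ _ hε => exists_minimalError_anovaWeight_le γ s hε.1,
    spt_iff,
    sptExponent_eq,
    ⟨SPT.pt, fun h => spt_of_sumExponent_lt_top (sumExponent_lt_top_of_pt h)⟩,
    ⟨fun h => weightInf_lt_one_of_wt h.uwt.wt, qpt_of_weightInf_lt_one⟩,
    ⟨fun h => weightInf_lt_one_of_wt h.wt, fun h => (qpt_of_weightInf_lt_one h).uwt⟩,
    ⟨weightInf_lt_one_of_wt, fun h => (qpt_of_weightInf_lt_one h).uwt.wt⟩,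
    qptExponent_eq,
    fun _ _ => weakTractability_of_one_lt⟩
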